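/- All graphs are finite and simple. A \emph{cover} of a graph $G$ is a pair $\mathcal{H}=(L,H)$ consisting of a graph $H$ and a function $L$ from $V(G)$ to the subsets of $V(H)$ such that: (1) the sets $L(u)$, $u\in V(G)$, are nonempty, pairwise disjoint and have union $V(H)$; (2) $L(u)$ is a clique in $H$ for every $u\in V(G)$; (3) if $u\neq v$ and $uv\notin E(G)$, then $H$ has no edge between $L(u)$ and $L(v)$; (4) if $uv\in E(G)$, then the edges of $H$ between $L(u)$ and $L(v)$ form a (possibly empty) matching. The cover is \emph{$m$-fold} if $|L(u)|=m$ for every $u\in V(G)$. An \emph{$\mathcal{H}$-coloring} of $G$ is an independent set of $H$ of size $|V(G)|$. For integers $m\ge 1$, the \emph{DP color function} $P_{DP}(G,m)$ is the minimum, over all $m$-fold covers $\mathcal{H}$ of $G$, of the number of $\mathcal{H}$-colorings of $G$, and $P(G,m)$ is the number of proper $m$-colorings of $G$. The \emph{DP color function threshold} $\tau_{DP}(G)$ is the smallest integer $N\ge\chi(G)$ such that $P_{DP}(G,m)=P(G,m)$ for all $m\ge N$, and $\tau_{DP}(G)=\infty$ if there is no such $N$. \textbf{Theorem.} Let $n\ge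 1$, let $k_1,\dots,k_n\ge 3$ be integers, let $G$ be the disjoint union of the cycles $C_{k_1},\dots,C_{k_n}$, and let $M=K_1\vee G$ be the cone over $G$, that is, $G$ together with one new vertex adjacent to all vertices of $G$. Then \[ \tau_{DP}(M)=\begin{cases}5 & \text{if there exist distinct } i,j\in\{1,\dots,n\} \text{ such that } k_i=k_j=4,\\ 4 & \text{otherwise.}\end{cases} \] -/

import Mathlib

namespace DPColoring

/-- A cover `(L, H)` of the graph `G`, where the graph `H` has vertex type `W`. The first two
fields say that the sets `L u`, `u ∈ V(G)`, are nonempty and pairwise distinct and are the classes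
of a partition of `V(H)`. -/
structure Cover {V : Type*} (G : SimpleGraph V) (W : Type*) where
  /-- the graph on the vertices of the cover -/
  H : SimpleGraph W
  /-- the list assigned to each vertex of `G` -/
  L : V → Set W
  nonempty : ∀ u, (L u).Nonempty
  partition : ∀ x, ∃! u, x ∈ L u
  isClique : ∀ u, H.IsClique (L u)
  eq_or_adj : ∀ u v x y, x ∈ L u → y ∈ L v → H.Adj x y → u = v ∨ G.Adj u v
  /-- The edges of `H` between `L u` and `L v` form a (possibly empty) matching. Since `G.Adj` is
  symmetric, the condition for `(v, u)` bounds the number of neighbours in the other direction. -/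
  matching : ∀ u v, G.Adj u v → ∀ x ∈ L u, ∀ y ∈ L v, ∀ z ∈ L v, H.Adj x y → H.Adj x z → y = z

/-- A cover is `m`-fold if all its lists have exactly `m` elements. -/
def Cover.IsFold {V : Type*} {G : SimpleGraph V} {W : Type*} (C : Cover G W) (m : ℕ) : Prop :=
  ∀ u, (C.L u).encard = m

/-- The colorings of `G` from the cover: independent sets of `H` of size `|V(G)|`. -/
def Cover.colorings {V : Type*} {G : SimpleGraph V} {W : Type*} (C : Cover G W) : Set (Set W) :=
  {I | C.H.IsIndepSet I ∧ I.encard = ENat.card V}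

/-- The DP color function: the minimum, over all `m`-fold covers of the finite graph `G`, of the
number of colorings of `G` from the cover. (Since `G` is finite, every `m`-fold cover is finite, so
up to isomorphism its vertices form a finite type in the lowest universe.) -/
noncomputable def dpColorFunction {V : Type*} (G : SimpleGraph V) (m : ℕ) : ℕ :=
  sInf {N | ∃ (W : Type) (_ : Finite W) (C : Cover G W), C.IsFold m ∧ N = C.colorings.ncard}

/-- The chromatic polynomial at `m`: the number of proper `m`-colorings. -/
noncomputable def chromaticCount {V : Type*} (G : SimpleGraph V) (m : ℕ) : ℕ :=
  Nat.card (G.Coloring (Fin m))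

/-- The DP color function threshold: the smallest natural number `N ≥ χ(G)` such that the DP color
function and the chromatic polynomial of `G` agree at all `m ≥ N`, and `⊤` if there is none. -/
noncomputable def dpThreshold {V : Type*} (G : SimpleGraph V) : ℕ∞ :=
  sInf {t | ∃ N : ℕ, t = N ∧ G.chromaticNumber ≤ N ∧
    ∀ m : ℕ, N ≤ m → dpColorFunction G m = chromaticCount G m}

/-- The join of two vertex disjoint graphs. -/
def join {V W : Type*} (G : SimpleGraph V) (H : SimpleGraph W) : SimpleGraph (V ⊕ W) :=
  SimpleGraph.sum G H ⊔ completeBipartiteGraph V W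

/-- The cone over a graph: the join of `K₁` with it. -/
def cone {V : Type*} (G : SimpleGraph V) : SimpleGraph (Fin 1 ⊕ V) :=
  join (⊤ : SimpleGraph (Fin 1)) G

/-- The disjoint union of the cycles `C_{k i}`, with copy `i` living on the `i`-th summand. -/
def disjointCycles {n : ℕ} (k : Fin n → ℕ) : SimpleGraph (Σ i, Fin (k i)) :=
  ⨆ i, (SimpleGraph.cycleGraph (k i)).map (Function.Embedding.sigmaMk i)

end DPColoring

namespace DPColoring

open Finset Equiv

/-! Completing all matchings to perfect ones only destroys colorings, and the colors can be renamed
so that every matching at the cone vertex is the identity. A coloring is then a color `c` of the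
cone vertex together with a coloring of each cycle avoiding `c` (`permCount_cone_disjointCycles`).
So ∑_c ∏_i N_i(c) has to be compared with m ∏_i P_i, where P_i counts the proper (m-1)-colorings of
the i-th cycle.

Transfer matrices (`sum_walk`) express closed walk counts through fixed points of the composite of
the matchings. On an odd cycle N_i(c) ≥ P_i. On an even cycle of length K, let F be the set of
colors fixed by all matchings and α = `walkConst (m - 1) (K - 1)`. A color c in F loses at most m -
|F|; for c outside F, erasing c breaks a matched pair, which gains a further α + 1. By AM-GM over c
it suffices that ∏_c N_i(c) ≥ P_i^m for each cycle, which follows from Bernoulli's inequality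
(`pow_mul_pow_ge`) unless m = K = 4.

For m = K = 4 and |F| = 2 the bounds are 16, 16, 20, 20: the sum is 4 · 18, but the product is below
18^4. A single 4-cycle is harmless: either all other cycles have N_i(c) ≥ P_i for every c and the
sum suffices, or another cycle has a product large enough to compensate. Two 4-cycles twisted by
disjoint transpositions pair each 20 with a 16, and 4 · 320 < 4 · 324. For m = 3, colorability
forces all cycles to be even, and one transposition lowers the counts 2, 2, 2 to 2, 2, 0. -/

/-! ### Walks avoiding permutations -/

/-- The number of walks of length `k` between two given distinct vertices of a complete graph on
`r` vertices; it satisfies `r * walkConst r k = (r - 1) ^ k - (-1) ^ k`. -/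
def walkConst (r : ℤ) : ℕ → ℤ
  | 0 => 0
  | k + 1 => (r - 1) * walkConst r k + (-1) ^ k

/-- With J the all-ones matrix and Q_j the permutation matrices, a product of k factors J - Q_j is a
multiple of J plus (-1)^k times the product of the Q_j, since J absorbs permutations. The test
function `h` reads off this matrix identity. -/
theorem sum_walk {α : Type*} [Fintype α] [DecidableEq α] (k : ℕ) (τ : Fin k → Perm α) :
    ∃ π : Perm α, (∀ z, (∀ j, τ j z = z) → π z = z) ∧ ∀ h : α → α → ℤ,
      ∑ g : Fin (k + 1) → α, (∏ j : Fin k, if τ j (g j.castSucc) = g j.succ then 0 else 1) *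
        h (g 0) (g (Fin.last k)) =
      walkConst (Fintype.card α) k * ∑ x, ∑ y, h x y + (-1) ^ k * ∑ x, h x (π x) := by
  induction k with
  | zero =>
    refine ⟨1, fun _ _ => rfl, fun h => ?_⟩
    rw [← (Equiv.funUnique (Fin 1) α).symm.sum_comp]
    simp [walkConst]
  | succ k ih =>
    obtain ⟨π, hπ, H⟩ := ih fun j => τ j.castSucc
    refine ⟨τ (Fin.last k) * π, fun z hz => ?_, fun h => ?_⟩
    · rw [Perm.mul_apply, hπ z fun j => hz _, hz]
    -- Summing out the last vertex of the walk replaces `h` by this test function.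
    have key := H fun x y => ∑ z, h x z - h x (τ (Fin.last k) y)
    have hperm : ∀ x, ∑ y, h x (τ (Fin.last k) y) = ∑ y, h x y := fun x =>
      Equiv.sum_comp (τ (Fin.last k)) (h x)
    rw [← (Fin.snocEquiv fun _ : Fin (k + 2) => α).sum_comp, Fintype.sum_prod_type_right]
    have hl : ∀ g : Fin (k + 1) → α, ∑ z : α,
        (∏ j : Fin (k + 1), if τ j ((Fin.snocEquiv fun _ : Fin (k + 2) => α) (z, g) j.castSucc) =
          (Fin.snocEquiv fun _ : Fin (k + 2) => α) (z, g) j.succ then (0 : ℤ) else 1) *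
        h ((Fin.snocEquiv fun _ : Fin (k + 2) => α) (z, g) 0)
          ((Fin.snocEquiv fun _ : Fin (k + 2) => α) (z, g) (Fin.last (k + 1))) =
        (∏ j : Fin k, if τ j.castSucc (g j.castSucc) = g j.succ then 0 else 1) *
          (∑ z, h (g 0) z - h (g 0) (τ (Fin.last k) (g (Fin.last k)))) := by
      intro g
      have h0 : ∀ z, (Fin.snoc g z : Fin (k + 2) → α) 0 = g 0 := fun z => by
        rw [← Fin.castSucc_zero, Fin.snoc_castSucc]
      simp only [Fin.snocEquiv_apply, Fin.prod_univ_castSucc, Fin.succ_castSucc,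
        Fin.snoc_castSucc, Fin.succ_last, Fin.snoc_last, h0, mul_assoc, ← mul_sum]
      congr 1
      simp [sum_ite, filter_ne, ite_mul, sum_erase_eq_sub]
    rw [sum_congr rfl fun g _ => hl g, key]
    simp only [sum_sub_distrib, hperm, sum_const, card_univ, nsmul_eq_mul, walkConst, pow_succ,
      Perm.mul_apply]
    rw [← mul_sum]
    ring

/-- The number of closed walks `g` in `α` indexed cyclically by `Fin K`, such that no consecutive
pair is forbidden by `R`. -/
noncomputable def closedCount {α : Type*} (K : ℕ) (R : Fin K → α → α → Prop) : ℕ :=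
  Nat.card {g : Fin K → α // ∀ j, ¬ R j (g j) (g (finRotate K j))}

theorem closedCount_anti {α : Type*} [Finite α] {K : ℕ} {R S : Fin K → α → α → Prop}
    (h : ∀ j x y, R j x y → S j x y) : closedCount K S ≤ closedCount K R :=
  Nat.card_le_card_of_injective
    (fun g => (⟨g.1, fun j hj => g.2 j (h _ _ _ hj)⟩ :
      {g : Fin K → α // ∀ j, ¬ R j (g j) (g (finRotate K j))}))
    fun _ _ hab => Subtype.ext (congrArg Subtype.val hab :)

theorem closedCount_rotate {α : Type*} {K : ℕ} (R : Fin K → α → α → Prop) (e : Perm (Fin K))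
    (he : e * finRotate K = finRotate K * e) :
    closedCount K (fun j => R (e j)) = closedCount K R := by
  have he' : ∀ j, e (finRotate K j) = finRotate K (e j) := fun j => Perm.congr_fun he j
  refine Nat.card_congr ((Equiv.arrowCongr e (Equiv.refl α)).subtypeEquiv fun g => ?_)
  rw [← e.forall_congr_right (q := fun j => ¬ R j (_) (_))]
  refine forall_congr' fun j => ?_
  simp only [← he', Equiv.arrowCongr_apply, Function.comp_apply, Equiv.symm_apply_apply,
    Equiv.refl_apply]

theorem closedCount_eq_sum {α : Type*} [Fintype α] {k : ℕ}
    (R : Fin (k + 1) → α → α → Prop) [∀ j x y, Decidable (R j x y)] :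
    (closedCount (k + 1) R : ℤ) = ∑ g : Fin (k + 1) → α,
      (∏ j : Fin k, if R j.castSucc (g j.castSucc) (g j.succ) then 0 else 1) *
        if R (Fin.last k) (g (Fin.last k)) (g 0) then 0 else 1 := by
  classical
  rw [closedCount, Nat.card_eq_fintype_card, Fintype.card_subtype, card_filter]
  push_cast
  refine sum_congr rfl fun g _ => ?_
  have : (∀ j, ¬ R j (g j) (g (finRotate (k + 1) j))) ↔
      (∀ j : Fin k, ¬ R j.castSucc (g j.castSucc) (g j.succ)) ∧
        ¬ R (Fin.last k) (g (Fin.last k)) (g 0) := by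
    simp only [Fin.forall_fin_succ', finRotate_apply, Fin.coeSucc_eq_succ, Fin.last_add_one]
  rw [if_congr this rfl rfl]
  by_cases h1 : ∀ j : Fin k, ¬ R j.castSucc (g j.castSucc) (g j.succ)
  · rw [prod_congr rfl fun j _ => if_neg (h1 j)]
    simp only [h1, prod_const_one, one_mul, implies_true, true_and, not_false_eq_true, ite_not]
  · rw [if_neg fun h => h1 h.1]
    push Not at h1
    obtain ⟨j, hj⟩ := h1
    refine (mul_eq_zero_of_left (prod_eq_zero (mem_univ j) ?_) _).symm
    exact if_pos hj

/-- The number of closed walks avoiding the pairs `(x, τ j x)`. -/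
theorem closedCount_perm {α : Type*} [Fintype α] [DecidableEq α] (k : ℕ)
    (τ : Fin (k + 1) → Perm α) :
    ∃ π : Perm α, (∀ z, (∀ j : Fin k, τ j.castSucc z = z) → π z = z) ∧
      (closedCount (k + 1) (fun j x y => τ j x = y) : ℤ) =
        Fintype.card α * (Fintype.card α - 1) * walkConst (Fintype.card α) k +
          (-1) ^ k * (Fintype.card α - #{x | τ (Fin.last k) (π x) = x}) := by
  obtain ⟨π, hπ, H⟩ := sum_walk k fun j => τ j.castSucc
  refine ⟨π, hπ, ?_⟩
  rw [closedCount_eq_sum, H fun x y => if τ (Fin.last k) y = x then 0 else 1]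
  have h1 : ∀ x, ∑ y, (if τ (Fin.last k) y = x then (0 : ℤ) else 1) = Fintype.card α - 1 := by
    intro x
    have : ∀ y, (if τ (Fin.last k) y = x then (0 : ℤ) else 1) =
        1 - if y = (τ (Fin.last k)).symm x then 1 else 0 := fun y => by
      rw [if_congr (Equiv.eq_symm_apply _).symm rfl rfl]; split_ifs <;> rfl
    simp [this]
  have h2 : ∑ x, (if τ (Fin.last k) (π x) = x then (0 : ℤ) else 1) =
      Fintype.card α - #{x | τ (Fin.last k) (π x) = x} := by
    have : ∀ x, (if τ (Fin.last k) (π x) = x then (0 : ℤ) else 1) =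
        1 - if τ (Fin.last k) (π x) = x then 1 else 0 := fun x => by
      split_ifs <;> rfl
    rw [sum_congr rfl fun x _ => this x, sum_sub_distrib, sum_boole]
    simp
  simp only [h1, h2, sum_const, card_univ, nsmul_eq_mul]
  ring

/-- The number of closed walks avoiding the pairs `(x, τ j x)`, except that one of these pairs
is permitted for the last value of `j`. -/
theorem closedCount_perm_except {α : Type*} [Fintype α] [DecidableEq α] (k : ℕ)
    (τ : Fin (k + 1) → Perm α) (y₀ : α) :
    ∃ π : Perm α, (∀ z, (∀ j : Fin k, τ j.castSucc z = z) → π z = z) ∧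
      (closedCount (k + 1) (fun j x y => τ j x = y ∧ ¬ (j = Fin.last k ∧ x = y₀)) : ℤ) =
        Fintype.card α * (Fintype.card α - 1) * walkConst (Fintype.card α) k +
          walkConst (Fintype.card α) k +
          (-1) ^ k * (Fintype.card α - #{x | τ (Fin.last k) (π x) = x} +
            if π (τ (Fin.last k) y₀) = y₀ then 1 else 0) := by
  obtain ⟨π, hπ, H⟩ := sum_walk k fun j => τ j.castSucc
  refine ⟨π, hπ, ?_⟩
  rw [closedCount_eq_sum]
  have hne : ∀ j : Fin k, j.castSucc ≠ Fin.last k := fun j => (Fin.castSucc_lt_last j).ne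
  simp only [hne, false_and, not_false_eq_true, and_true, true_and]
  rw [H fun x y => if τ (Fin.last k) y = x ∧ ¬ y = y₀ then 0 else 1]
  -- The permitted pair adds back a single matrix entry, at `(τ y₀, y₀)`.
  have h0 : ∀ x y, (if τ (Fin.last k) y = x ∧ ¬ y = y₀ then (0 : ℤ) else 1) =
      1 - (if y = (τ (Fin.last k)).symm x then 1 else 0) +
        if y = y₀ then if x = τ (Fin.last k) y₀ then 1 else 0 else 0 := by
    intro x y
    rw [if_congr (Equiv.eq_symm_apply (τ (Fin.last k))) rfl rfl]
    by_cases h1 : y = y₀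
    · subst h1
      by_cases h2 : τ (Fin.last k) y = x
      · subst h2; simp
      · simp [h2, Ne.symm h2]
    · simp [h1]; split_ifs <;> rfl
  have h1 : ∑ x, ∑ y, (if τ (Fin.last k) y = x ∧ ¬ y = y₀ then (0 : ℤ) else 1) =
      Fintype.card α * (Fintype.card α - 1) + 1 := by
    simp only [h0, sum_add_distrib, sum_sub_distrib, sum_ite_eq', mem_univ, if_true, sum_const,
      card_univ, nsmul_eq_mul]
    ring
  have h2 : ∑ x, (if τ (Fin.last k) (π x) = x ∧ ¬ π x = y₀ then (0 : ℤ) else 1) =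
      Fintype.card α - #{x | τ (Fin.last k) (π x) = x} +
        if π (τ (Fin.last k) y₀) = y₀ then 1 else 0 := by
    have : ∀ x, (if τ (Fin.last k) (π x) = x ∧ ¬ π x = y₀ then (0 : ℤ) else 1) =
        1 - (if τ (Fin.last k) (π x) = x then 1 else 0) +
        if x = τ (Fin.last k) y₀ then
          if π (τ (Fin.last k) y₀) = y₀ then 1 else 0
        else 0 := fun x => by
      by_cases h1 : x = τ (Fin.last k) y₀
      · subst h1
        simp only [EmbeddingLike.apply_eq_iff_eq]
        by_cases h3 : π (τ (Fin.last k) y₀) = y₀ <;> simp [h3]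
      · by_cases h2 : π x = y₀
        · simp [h1, h2, Ne.symm h1]
        · simp [h1, h2]; split_ifs <;> rfl
    rw [sum_congr rfl fun x _ => this x, sum_add_distrib, sum_sub_distrib, sum_boole]
    simp
  rw [h1, h2]
  ring

theorem closedCount_perm_of_even {α : Type*} [Fintype α] [DecidableEq α] {k : ℕ} (hk : Even k)
    (τ : Fin (k + 1) → Perm α) :
    (Fintype.card α * (Fintype.card α - 1) * walkConst (Fintype.card α) k : ℤ) ≤
      closedCount (k + 1) (fun j x y => τ j x = y) := by
  obtain ⟨π, -, h⟩ := closedCount_perm k τ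
  rw [h, hk.neg_one_pow]
  have : #{x | τ (Fin.last k) (π x) = x} ≤ Fintype.card α := card_le_univ _
  zify at this
  linarith

theorem closedCount_perm_of_odd {α : Type*} [Fintype α] [DecidableEq α] {k : ℕ} (hk : Odd k)
    (τ : Fin (k + 1) → Perm α) (F : Finset α) (hF : ∀ z ∈ F, ∀ j, τ j z = z) :
    (Fintype.card α * (Fintype.card α - 1) * walkConst (Fintype.card α) k - Fintype.card α + #F : ℤ)
      ≤ closedCount (k + 1) (fun j x y => τ j x = y) := by
  obtain ⟨π, hπ, h⟩ := closedCount_perm k τ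
  rw [h, hk.neg_one_pow]
  have : #F ≤ #{x | τ (Fin.last k) (π x) = x} := card_le_card fun z hz => by
    simp [hπ z fun j => hF z hz _, hF z hz]
  zify at this
  linarith

theorem closedCount_perm_except_of_odd {α : Type*} [Fintype α] [DecidableEq α] {k : ℕ} (hk : Odd k)
    (τ : Fin (k + 1) → Perm α) (F : Finset α) (hF : ∀ z ∈ F, ∀ j, τ j z = z) (j₀ : Fin (k + 1))
    (y₀ : α) (hy : y₀ ∉ F) :
    (Fintype.card α * (Fintype.card α - 1) * walkConst (Fintype.card α) k +
      walkConst (Fintype.card α) k - Fintype.card α + #F : ℤ)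
      ≤ closedCount (k + 1) (fun j x y => τ j x = y ∧ ¬ (j = j₀ ∧ x = y₀)) := by
  -- Rotating the cycle moves the edge with the permitted pair to the last place.
  set e : Perm (Fin (k + 1)) := Equiv.addRight (j₀ - Fin.last k)
  have hl : e (Fin.last k) = j₀ := by simp [e]
  rw [← closedCount_rotate _ e (by ext1 j; simp [e, add_right_comm])]
  obtain ⟨π, hπ, h⟩ := closedCount_perm_except k (fun j => τ (e j)) y₀
  have hR : (fun j x y => τ (e j) x = y ∧ ¬ (e j = j₀ ∧ x = y₀)) =
      fun j x y => τ (e j) x = y ∧ ¬ (j = Fin.last k ∧ x = y₀) := by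
    funext j x y
    rw [← hl, e.apply_eq_iff_eq]
  rw [hR, h, hk.neg_one_pow, hl]
  have hsub : F ⊆ ({x | τ j₀ (π x) = x} : Finset α) := fun z hz => by
    simp [hπ z fun j => hF z hz _, hF z hz]
  have hnot : τ j₀ y₀ ∉ F := fun hmem => by
    have := hF _ hmem j₀
    rw [(τ j₀).apply_eq_iff_eq] at this
    exact hy (this ▸ hmem)
  -- In the first case the lost 1 is compensated by `τ j₀ y₀`, a fixed point of the composite
  -- outside `F`.
  split_ifs with hp
  · have : #(insert (τ j₀ y₀) F) ≤ #{x | τ j₀ (π x) = x} :=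
      card_le_card (insert_subset (by simp [hp]) hsub)
    rw [card_insert_of_notMem hnot] at this
    zify at this
    linarith
  · have : #F ≤ #{x | τ j₀ (π x) = x} := card_le_card hsub
    zify at this
    linarith

/-! ### Coloring a cycle with one color erased -/

/-- The permutation of the complement of `c` induced by `σ`, which maps `σ⁻¹ c` to `σ c` if these
differ from `c`. -/
def permErase {β : Type*} [DecidableEq β] (σ : Perm β) (c : β) : Perm {x // x ≠ c} :=
  (swap c (σ c) * σ).subtypePerm fun x => by
    rw [not_iff_not, Perm.mul_apply, ← Equiv.eq_symm_apply, symm_swap, swap_apply_left,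
      σ.apply_eq_iff_eq]

theorem permErase_apply {β : Type*} [DecidableEq β] {σ : Perm β} {c : β} {x y : {x // x ≠ c}}
    (h : σ x = y) : permErase σ c x = y := by
  refine Subtype.ext ?_
  change swap c (σ c) (σ x) = y
  rw [swap_apply_of_ne_of_ne (h ▸ y.2) fun h' => x.2 (σ.injective h'), h]

theorem permErase_apply_iff {β : Type*} [DecidableEq β] {σ : Perm β} {c : β}
    {x y : {x // x ≠ c}} : σ x = y ↔ permErase σ c x = y ∧ ¬ (σ x = c) := by
  refine ⟨fun h => ⟨permErase_apply h, h ▸ y.2⟩, fun ⟨h, h'⟩ => ?_⟩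
  rw [← h, permErase_apply (y := ⟨σ x, h'⟩) rfl]

/-- The number of colorings of a cycle of length `K` from the cover with lists `Fin m` and
matchings `σ`, in which the color `c` is not used. -/
noncomputable def cycleCount {K m : ℕ} (σ : Fin K → Perm (Fin m)) (c : Fin m) : ℕ :=
  closedCount K fun j (x y : {x // x ≠ c}) => σ j x = y

/-- The number of proper colorings of a cycle of length `K` with `m - 1` colors. -/
def cyclePoly (K m : ℕ) : ℤ := ((m : ℤ) - 1) * (m - 2) * walkConst (m - 1) (K - 1)

theorem card_ne_fin {m : ℕ} (c : Fin m) : (Fintype.card {x // x ≠ c} : ℤ) = m - 1 := by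
  have := c.pos
  simp [Fintype.card_subtype_compl, Nat.cast_sub (Nat.succ_le_of_lt this)]

/-- `permErase` forbids every pair that the restricted matching forbids, so passing to it can only
lower the count. -/
theorem cycleCount_of_odd {K m : ℕ} (hK : Odd K) (σ : Fin K → Perm (Fin m)) (c : Fin m) :
    cyclePoly K m ≤ cycleCount σ c := by
  obtain ⟨k, rfl⟩ := Nat.exists_eq_succ_of_ne_zero hK.pos.ne'
  have := closedCount_perm_of_even (by simpa [Nat.odd_add_one] using hK)
    fun j => permErase (σ j) c
  rw [card_ne_fin] at this
  have h2 := closedCount_anti fun j (x y : {x // x ≠ c}) (h : σ j x = y) => permErase_apply h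
  rw [cyclePoly, cycleCount, Nat.succ_sub_one]
  zify at h2
  linarith

/-- The colors that are matched with themselves by all matchings. -/
def fixedColors {K m : ℕ} (σ : Fin K → Perm (Fin m)) : Finset (Fin m) := {z | ∀ j, σ j z = z}

theorem cycleCount_of_mem {K m : ℕ} (hK : Even K) (h0 : 0 < K) (σ : Fin K → Perm (Fin m))
    (c : Fin m) (hc : c ∈ fixedColors σ) :
    cyclePoly K m - m + #(fixedColors σ) ≤ cycleCount σ c := by
  obtain ⟨k, rfl⟩ := Nat.exists_eq_succ_of_ne_zero h0.ne'
  have := closedCount_perm_of_odd (by simpa [Nat.even_add_one] using hK)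
    (fun j => permErase (σ j) c) ((fixedColors σ).subtype (· ≠ c)) fun z hz j => by
      simp only [fixedColors, mem_subtype, mem_filter, mem_univ, true_and] at hz
      exact permErase_apply (hz j)
  rw [card_ne_fin, card_subtype, filter_ne', card_erase_of_mem hc,
    Nat.cast_sub (card_pos.2 ⟨c, hc⟩)] at this
  have h2 := closedCount_anti fun j (x y : {x // x ≠ c}) (h : σ j x = y) => permErase_apply h
  rw [cyclePoly, cycleCount, Nat.succ_sub_one]
  zify at h2
  push_cast at this
  linarith

theorem cycleCount_of_notMem {K m : ℕ} (hK : Even K) (σ : Fin K → Perm (Fin m))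
    (c : Fin m) (hc : c ∉ fixedColors σ) :
    cyclePoly K m + walkConst (m - 1) (K - 1) + 1 - m + #(fixedColors σ) ≤ cycleCount σ c := by
  obtain ⟨j₀, hj⟩ : ∃ j, σ j c ≠ c := by simpa [fixedColors] using hc
  obtain ⟨k, rfl⟩ := Nat.exists_eq_succ_of_ne_zero (j₀.pos).ne'
  have hy : (σ j₀).symm c ≠ c := fun h => hj ((Equiv.symm_apply_eq _).1 h).symm
  have := closedCount_perm_except_of_odd (by simpa [Nat.even_add_one] using hK)
    (fun j => permErase (σ j) c) ((fixedColors σ).subtype (· ≠ c)) (fun z hz j => by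
      simp only [fixedColors, mem_subtype, mem_filter, mem_univ, true_and] at hz
      exact permErase_apply (hz j)) j₀ ⟨_, hy⟩ fun h => by
        simp only [fixedColors, mem_subtype, mem_filter, mem_univ, true_and] at h
        exact hy (by simpa using (h j₀).symm)
  rw [card_ne_fin, card_subtype, filter_ne', erase_eq_of_notMem hc] at this
  -- The color matched to `c` on edge `j₀` has lost its partner, so the pair that `permErase` adds
  -- there is really permitted.
  have h2 := closedCount_anti fun j (x y : {x // x ≠ c}) (h : σ j x = y) =>
    (⟨permErase_apply h, fun ⟨h1, h2⟩ => y.2 (by rw [← h, h1, h2]; simp)⟩ :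
      permErase (σ j) c x = y ∧ ¬ (j = j₀ ∧ x = ⟨_, hy⟩))
  rw [cyclePoly, cycleCount, Nat.succ_sub_one]
  zify at h2
  linarith

theorem cycleCount_one {K m : ℕ} (h0 : 0 < K) (c : Fin m) :
    (cycleCount (fun _ : Fin K => (1 : Perm (Fin m))) c : ℤ) = cyclePoly K m := by
  obtain ⟨k, rfl⟩ := Nat.exists_eq_succ_of_ne_zero h0.ne'
  obtain ⟨π, hπ, h⟩ := closedCount_perm (α := {x // x ≠ c}) k fun _ => 1
  have : #{x | (1 : Perm {x // x ≠ c}) (π x) = x} = Fintype.card {x // x ≠ c} := by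
    simp [fun x => hπ x fun _ => rfl]
  rw [this, sub_self, mul_zero, add_zero, card_ne_fin] at h
  rw [cyclePoly, cycleCount, Nat.succ_sub_one]
  convert h using 3
  · simp [Subtype.ext_iff]
  · ring

/-- Matchings of a cycle: the last one is `π`, the others are trivial. -/
def twist (K : ℕ) {m : ℕ} (π : Perm (Fin m)) (j : Fin K) : Perm (Fin m) :=
  if (j : ℕ) + 1 = K then π else 1

theorem cycleCount_twist_of_ne {K m : ℕ} (hK : Even K) (h0 : 0 < K) {a b c : Fin m} (hab : a ≠ b)
    (hac : a ≠ c) (hbc : b ≠ c) :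
    (cycleCount (twist K (swap a b)) c : ℤ) = cyclePoly K m - 2 := by
  obtain ⟨k, rfl⟩ := Nat.exists_eq_succ_of_ne_zero h0.ne'
  have hk : Odd k := by simpa [Nat.even_add_one] using hK
  have hs : ∀ j x, twist (k + 1) (swap a b) j x = c ↔ x = c := fun j x => by
    have hc : twist (k + 1) (swap a b) j c = c := by
      rw [twist]
      split_ifs
      · exact swap_apply_of_ne_of_ne hac.symm hbc.symm
      · rfl
    exact ⟨fun h => (Equiv.injective _) (h.trans hc.symm), fun h => h ▸ hc⟩
  obtain ⟨π, hπ, h⟩ := closedCount_perm k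
    fun j => permErase (twist (k + 1) (swap a b) j) c
  have hπ' : ∀ x, π x = x := fun x => hπ x fun j => permErase_apply <| by
    simp [twist, j.2.ne]
  have hfix : (#{x | permErase (twist (k + 1) (swap a b) (Fin.last k)) c (π x) = x} : ℤ) =
      Fintype.card {x // x ≠ c} - 2 := by
    have h2 := card_filter_add_card_filter_not (s := (univ : Finset {x // x ≠ c}))
      fun x => permErase (twist (k + 1) (swap a b) (Fin.last k)) c (π x) = x
    have h3 : ({x | ¬ permErase (twist (k + 1) (swap a b) (Fin.last k)) c (π x) = x} :
        Finset {x // x ≠ c}) = {⟨a, hac⟩, ⟨b, hbc⟩} := by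
      ext x
      have h4 : permErase (twist (k + 1) (swap a b) (Fin.last k)) c x = x ↔ swap a b x = x := by
        have := permErase_apply_iff (σ := twist (k + 1) (swap a b) (Fin.last k)) (x := x) (y := x)
        rw [hs, eq_false x.2, not_false_eq_true, and_true] at this
        rw [← this, twist, if_pos (by simp)]
      simp only [hπ', mem_filter, mem_univ, true_and, h4, mem_insert, mem_singleton]
      simp only [Subtype.ext_iff]
      rw [← Ne, swap_apply_ne_self_iff]
      simp [hab]
    rw [h3, card_pair (by simpa [Subtype.ext_iff] using hab), card_univ] at h2
    omega
  rw [hfix, card_ne_fin, hk.neg_one_pow] at h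
  rw [cyclePoly, cycleCount, Nat.succ_sub_one]
  have hR : (fun j (x y : {x // x ≠ c}) => twist (k + 1) (swap a b) j x = y) =
      fun j x y => permErase (twist (k + 1) (swap a b) j) c x = y := by
    funext j x y
    rw [permErase_apply_iff, hs, eq_false x.2, not_false_eq_true, and_true]
  rw [hR, h]
  ring

/-- Once `a` is erased, `b` has no partner on the last edge, and all other forbidden pairs are those
of the identity. -/
theorem cycleCount_twist_left {K m : ℕ} (hK : Even K) (h0 : 0 < K) {a b : Fin m} (hab : a ≠ b) :
    (cycleCount (twist K (swap a b)) a : ℤ) = cyclePoly K m + walkConst (m - 1) (K - 1) - 1 := by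
  obtain ⟨k, rfl⟩ := Nat.exists_eq_succ_of_ne_zero h0.ne'
  have hk : Odd k := by simpa [Nat.even_add_one] using hK
  obtain ⟨π, hπ, h⟩ := closedCount_perm_except k (fun _ => 1) (⟨b, hab.symm⟩ : {x // x ≠ a})
  have hπ' : ∀ x, π x = x := fun x => hπ x fun _ => rfl
  have hR : (fun j (x y : {x // x ≠ a}) => twist (k + 1) (swap a b) j x = y) =
      fun j x y => (1 : Perm {x // x ≠ a}) x = y ∧ ¬ (j = Fin.last k ∧ x = ⟨b, hab.symm⟩) := by
    funext j x y
    by_cases hj : j = Fin.last k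
    · subst hj
      rw [twist, if_pos (by simp)]
      by_cases hx : (x : Fin m) = b
      · simp [Subtype.ext_iff, hx, y.2.symm]
      · rw [swap_apply_of_ne_of_ne x.2 hx]
        simp [Subtype.ext_iff, hx]
    · have : (j : ℕ) ≠ k := fun h => hj (Fin.ext h)
      simp [twist, this, hj, Subtype.ext_iff]
  rw [cyclePoly, cycleCount, Nat.succ_sub_one, hR, h]
  simp only [hπ', Perm.one_apply, filter_true, card_univ, if_true, card_ne_fin, hk.neg_one_pow]
  ring

/-! ### Size of the walk numbers -/

theorem walkConst_add_two (r : ℤ) (k : ℕ) :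
    walkConst r (k + 2) = (r - 1) ^ 2 * walkConst r k + (r - 2) * (-1) ^ k := by
  simp only [walkConst, pow_succ]
  ring

theorem walkConst_pos {r : ℤ} (hr : 3 ≤ r) {k : ℕ} (hk : 1 ≤ k) : 1 ≤ walkConst r k := by
  induction k, hk using Nat.le_induction with
  | base => simp [walkConst]
  | succ k hk ih =>
    have : -1 ≤ (-1 : ℤ) ^ k := by rcases neg_one_pow_eq_or ℤ k with h | h <;> simp [h]
    rw [walkConst]
    nlinarith

theorem walkConst_two_of_even {k : ℕ} (hk : Even k) : walkConst 2 k = 0 := by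
  obtain ⟨j, rfl⟩ := hk
  induction j with
  | zero => rfl
  | succ j ih => rw [show j + 1 + (j + 1) = j + j + 2 by ring, walkConst_add_two, ih]; simp

theorem walkConst_two_of_odd {k : ℕ} (hk : Odd k) : walkConst 2 k = 1 := by
  obtain ⟨j, rfl⟩ := hk
  have h : walkConst 2 (2 * j + 1) = (2 - 1) * walkConst 2 (2 * j) + (-1) ^ (2 * j) := rfl
  simp [h, walkConst_two_of_even (even_two_mul j)]

theorem walkConst_mono_of_odd {r : ℤ} (hr : 3 ≤ r) {k : ℕ} (hk : Odd k) (i : ℕ) :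
    walkConst r k ≤ walkConst r (k + 2 * i) := by
  induction i with
  | zero => simp
  | succ i ih =>
    have hodd : Odd (k + 2 * i) := hk.add_even (even_two_mul i)
    have := walkConst_pos hr hodd.pos
    rw [show k + 2 * (i + 1) = k + 2 * i + 2 by ring, walkConst_add_two, hodd.neg_one_pow]
    nlinarith [mul_nonneg (show 0 ≤ r by linarith) (show 0 ≤ r - 2 by linarith)]

theorem walkConst_ge_of_odd {r : ℤ} (hr : 4 ≤ r) {k : ℕ} (hk : Odd k) (h3 : 3 ≤ k) :
    r + 1 ≤ walkConst r k := by
  obtain ⟨i, rfl⟩ : ∃ i, k = 3 + 2 * i := by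
    obtain ⟨j, rfl⟩ := hk
    exact ⟨j - 1, by omega⟩
  refine le_trans ?_ (walkConst_mono_of_odd (by linarith) (by decide) i)
  simp only [walkConst]
  nlinarith

theorem walkConst_three_ge_of_odd {k : ℕ} (hk : Odd k) (h3 : 5 ≤ k) : 11 ≤ walkConst 3 k := by
  obtain ⟨i, rfl⟩ : ∃ i, k = 5 + 2 * i := by
    obtain ⟨j, rfl⟩ := hk
    exact ⟨j - 2, by omega⟩
  refine le_trans ?_ (walkConst_mono_of_odd (by norm_num) (by decide) i)
  norm_num [walkConst]

/-! ### Bernoulli and AM-GM -/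

/-- Bernoulli is applied to both powers. Because f + t = r + 1, the linear terms add up to t(α -
r)/P; the cross term costs at most 2t/(3P). -/
theorem pow_mul_pow_ge {f t : ℕ} {r α P : ℝ} (hft : (f : ℝ) + t = r + 1) (hr : 3 ≤ r)
    (hα : r + 1 ≤ α) (hP : P = r * (r - 1) * α) :
    P ^ (f + t) * (1 + t / P * (α - r - 2 / 3)) ≤ (P - t) ^ f * (P + α + 1 - t) ^ t := by
  have hf0 : (0 : ℝ) ≤ f := f.cast_nonneg
  have ht0 : (0 : ℝ) ≤ t := t.cast_nonneg
  have hα0 : 0 < α := by linarith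
  have hrr : 6 ≤ r * (r - 1) := by nlinarith
  have hP0 : 0 < P := by rw [hP]; positivity
  have hPα : 6 * α ≤ P := by rw [hP]; nlinarith
  -- ft ≤ (r + 1)²/4, and r ≥ 3 gives the constant 2/3, with equality at r = 3, f = t = 2.
  have hle : (f : ℝ) * t ≤ 2 / 3 * (r * (r - 1)) := by
    have : ((f : ℝ) - t) ^ 2 = (r + 1) ^ 2 - 4 * (f * t) := by rw [← hft]; ring
    nlinarith [sq_nonneg ((f : ℝ) - t)]
  have htα : (t : ℝ) ≤ α + 1 := by linarith
  have h1 : 1 + (f : ℝ) * (-(t / P)) ≤ (1 + -(t / P)) ^ f := by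
    refine one_add_mul_le_pow ?_ f
    have : (t : ℝ) / P ≤ 1 := (div_le_one hP0).2 (by linarith)
    linarith
  have h2 : 1 + (t : ℝ) * ((α + 1 - t) / P) ≤ (1 + (α + 1 - t) / P) ^ t := by
    refine one_add_mul_le_pow ?_ t
    have : 0 ≤ (α + 1 - t) / P := div_nonneg (by linarith) hP0.le
    linarith
  have h3 : 1 + (t : ℝ) / P * (α - r - 2 / 3) ≤
      (1 + (f : ℝ) * (-(t / P))) * (1 + (t : ℝ) * ((α + 1 - t) / P)) := by
    have hkey : (f : ℝ) * t * (α + 1 - t) * t ≤ 2 / 3 * P * t := by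
      rcases Nat.eq_zero_or_pos t with h | h
      · simp [h]
      · have h' : (1 : ℝ) ≤ t := by exact_mod_cast h
        refine mul_le_mul_of_nonneg_right ?_ ht0
        calc (f : ℝ) * t * (α + 1 - t) ≤ f * t * α := by gcongr; linarith
          _ ≤ 2 / 3 * (r * (r - 1)) * α := by gcongr
          _ = 2 / 3 * P := by rw [hP]; ring
    have : (1 + (f : ℝ) * (-(t / P))) * (1 + (t : ℝ) * ((α + 1 - t) / P)) -
        (1 + (t : ℝ) / P * (α - r - 2 / 3)) =
        (2 / 3 * P * t - f * t * (α + 1 - t) * t) / P ^ 2 := by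
      rw [show (f : ℝ) = r + 1 - t by linarith]
      field_simp
      ring
    have : 0 ≤ (2 / 3 * P * t - f * t * (α + 1 - t) * t) / P ^ 2 :=
      div_nonneg (by linarith) (by positivity)
    linarith
  have h4 : 0 ≤ 1 + (f : ℝ) * (-(t / P)) := by
    have : (f : ℝ) * t / P ≤ 1 := (div_le_one hP0).2 (by rw [hP]; nlinarith)
    rw [mul_neg, ← mul_div_assoc]
    linarith
  have h5 : P ^ (f + t) * ((1 + -(t / P)) ^ f * (1 + (α + 1 - t) / P) ^ t) =
      (P - t) ^ f * (P + α + 1 - t) ^ t := by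
    rw [pow_add, mul_mul_mul_comm, ← mul_pow, ← mul_pow]
    congr 2 <;> field_simp <;> ring
  rw [← h5]
  refine mul_le_mul_of_nonneg_left (h3.trans ?_) (by positivity)
  have : 0 ≤ (t : ℝ) * ((α + 1 - t) / P) :=
    mul_nonneg ht0 (div_nonneg (by linarith) hP0.le)
  exact mul_le_mul h1 h2 (by linarith) (h4.trans h1)

theorem prod_ge_of_bounds {m : ℕ} (N : Fin m → ℝ) (F : Finset (Fin m)) {A B : ℝ} (hA : 0 ≤ A)
    (hB : 0 ≤ B) (h1 : ∀ c ∈ F, A ≤ N c) (h2 : ∀ c ∉ F, B ≤ N c) :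
    A ^ #F * B ^ (m - #F) ≤ ∏ c, N c := by
  rw [← prod_mul_prod_compl F]
  have hc : #Fᶜ = m - #F := by rw [card_compl, Fintype.card_fin]
  rw [← hc]
  rw [← prod_const, ← prod_const]
  exact mul_le_mul (prod_le_prod (fun _ _ => hA) h1)
    (prod_le_prod (fun _ _ => hB) fun c hc => h2 c (by simpa using hc)) (prod_nonneg fun _ _ => hB)
    (prod_nonneg fun c hc => hA.trans (h1 c hc))

theorem sum_ge_of_bounds {m : ℕ} (N : Fin m → ℝ) (F : Finset (Fin m)) {A B : ℝ}
    (h1 : ∀ c ∈ F, A ≤ N c) (h2 : ∀ c ∉ F, B ≤ N c) :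
    #F * A + (m - #F : ℕ) * B ≤ ∑ c, N c := by
  rw [← sum_add_sum_compl F]
  have hc : #Fᶜ = m - #F := by rw [card_compl, Fintype.card_fin]
  rw [← hc, ← nsmul_eq_mul, ← nsmul_eq_mul]
  exact add_le_add (card_nsmul_le_sum _ _ _ h1)
    (card_nsmul_le_sum _ _ _ fun c hc => h2 c (by simpa using hc))

/-- AM-GM, obtained by summing log y ≤ y - 1 over y = x c / B. -/
theorem mul_le_sum_of_pow_le_prod {m : ℕ} (x : Fin m → ℝ) (hx : ∀ c, 0 ≤ x c) {B : ℝ} (hB : 0 < B)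
    (h : B ^ m ≤ ∏ c, x c) : m * B ≤ ∑ c, x c := by
  have hpos : ∀ c, 0 < x c := fun c => (hx c).lt_of_ne fun h0 => by
    rw [prod_eq_zero (mem_univ c) h0.symm] at h
    exact absurd h (not_le.2 (by positivity))
  have h1 : (0 : ℝ) ≤ ∑ c, Real.log (x c / B) := by
    rw [← Real.log_prod fun c _ => (div_pos (hpos c) hB).ne', prod_div_distrib]
    refine Real.log_nonneg ((one_le_div (by simpa using by positivity)).2 ?_)
    simpa using h
  have h2 : ∑ c, Real.log (x c / B) ≤ ∑ c, (x c / B - 1) :=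
    sum_le_sum fun c _ => Real.log_le_sub_one_of_pos (div_pos (hpos c) hB)
  rw [sum_sub_distrib, ← sum_div] at h2
  simp only [sum_const, card_univ, Fintype.card_fin, nsmul_eq_mul, mul_one] at h2
  have := h1.trans h2
  rw [sub_nonneg, le_div_iff₀ hB] at this
  exact this

/-! ### Lower bounds for all covers -/

theorem cyclePoly_pos {K m : ℕ} (hK : 2 ≤ K) (hm : 4 ≤ m) : 0 < cyclePoly K m := by
  have hm' : (4 : ℤ) ≤ m := by exact_mod_cast hm
  have := walkConst_pos (r := (m : ℤ) - 1) (by linarith) (k := K - 1) (by omega)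
  exact mul_pos (mul_pos (by linarith) (by linarith)) (by linarith)

theorem odd_pred {K : ℕ} (hK : Even K) (h0 : 0 < K) : Odd (K - 1) :=
  Nat.Even.sub_odd h0 hK odd_one

/-- The hypothesis `hα` fails for m = K = 4, where the walk number is 3. -/
theorem prod_cycleCount_ge {K m : ℕ} (hK : Even K) (h0 : 2 ≤ K) (hm : 4 ≤ m)
    (hα : (m : ℤ) ≤ walkConst (m - 1) (K - 1)) (σ : Fin K → Perm (Fin m)) :
    (cyclePoly K m : ℝ) ^ m * (1 + (m - #(fixedColors σ) : ℝ) / cyclePoly K m *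
      (walkConst (m - 1) (K - 1) - (m - 1) - 2 / 3)) ≤ ∏ c, (cycleCount σ c : ℝ) := by
  set F := fixedColors σ
  set α : ℝ := (walkConst (m - 1) (K - 1) : ℝ) with hαdef
  have hF : #F ≤ m := by simpa using card_le_univ F
  have hm' : (4 : ℝ) ≤ m := by exact_mod_cast hm
  have hP0 : 0 < (cyclePoly K m : ℝ) := by exact_mod_cast cyclePoly_pos h0 hm
  have hα' : (m : ℝ) ≤ α := by rw [hαdef]; exact_mod_cast hα
  have hP : (cyclePoly K m : ℝ) = ((m : ℝ) - 1) * ((m : ℝ) - 1 - 1) * α := by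
    rw [cyclePoly, hαdef]; push_cast; ring
  have hPm : (m : ℝ) ≤ cyclePoly K m := by
    rw [hP]
    have : (1 : ℝ) ≤ ((m : ℝ) - 1) * ((m : ℝ) - 1 - 1) := by nlinarith
    nlinarith
  have hF0 : (0 : ℝ) ≤ #F := Nat.cast_nonneg _
  have hFm : (#F : ℝ) ≤ m := by exact_mod_cast hF
  have key := pow_mul_pow_ge (f := #F) (t := m - #F) (r := (m : ℝ) - 1) (α := α)
    (P := cyclePoly K m) (by push_cast [hF]; ring) (by linarith) (by linarith) hP
  rw [Nat.add_sub_cancel' hF, Nat.cast_sub hF] at key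
  refine key.trans (prod_ge_of_bounds _ F (by linarith) (by linarith) (fun c hc => ?_)
    fun c hc => ?_)
  · have := cycleCount_of_mem hK (by omega) σ c hc
    have : ((cyclePoly K m - m + #(fixedColors σ) : ℤ) : ℝ) ≤ (cycleCount σ c : ℤ) := by
      exact_mod_cast this
    push_cast at this
    linarith
  · have := cycleCount_of_notMem hK σ c hc
    have : ((cyclePoly K m + walkConst (m - 1) (K - 1) + 1 - m + #(fixedColors σ) : ℤ) : ℝ) ≤
      (cycleCount σ c : ℤ) := by exact_mod_cast this
    push_cast at this
    linarith

theorem cyclePoly_le_cycleCount_of_odd {K m : ℕ} (hK : Odd K) (σ : Fin K → Perm (Fin m))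
    (c : Fin m) : (cyclePoly K m : ℝ) ≤ cycleCount σ c := by
  exact_mod_cast cycleCount_of_odd hK σ c

theorem pow_cyclePoly_le_prod {K m : ℕ} (hK : 3 ≤ K) (hm : 4 ≤ m) (h : m ≠ 4 ∨ K ≠ 4)
    (σ : Fin K → Perm (Fin m)) :
    (cyclePoly K m : ℝ) ^ m ≤ ∏ c, (cycleCount σ c : ℝ) := by
  have hP0 : 0 < (cyclePoly K m : ℝ) := by exact_mod_cast cyclePoly_pos (by omega) hm
  rcases Nat.even_or_odd K with hev | hodd
  · have hα : (m : ℤ) ≤ walkConst (m - 1) (K - 1) := by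
      have hKo := odd_pred hev (by omega)
      have h4 : K ≠ 3 := by rintro rfl; exact absurd hev (by decide)
      by_cases h5 : m = 4
      · subst h5
        refine le_trans (by norm_num) (walkConst_three_ge_of_odd hKo ?_)
        have h6 : K ≠ 5 := by rintro rfl; exact absurd hev (by decide)
        omega
      · have : (5 : ℤ) ≤ m := by exact_mod_cast (by omega : 5 ≤ m)
        have := walkConst_ge_of_odd (r := (m : ℤ) - 1) (by linarith) hKo (by omega)
        linarith
    refine le_trans ?_ (prod_cycleCount_ge hev (by omega) hm hα σ)
    have hF : (#(fixedColors σ) : ℝ) ≤ m := by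
      exact_mod_cast (by simpa using card_le_univ (fixedColors σ))
    have hα' : (m : ℝ) ≤ walkConst (m - 1) (K - 1) := by exact_mod_cast hα
    refine le_mul_of_one_le_right (by positivity) (le_add_of_nonneg_right ?_)
    exact mul_nonneg (div_nonneg (by linarith) hP0.le) (by linarith)
  · simpa using prod_le_prod (s := univ) (fun (c : Fin m) _ => hP0.le)
      fun c _ => cyclePoly_le_cycleCount_of_odd hodd σ c

/-- If an even cycle has a non-fixed color, the gain factor is at least 1 + (α - 11/3)/(6α), and α ≥
11 makes this exceed 11/10. -/
theorem forall_le_or_prod_ge {K : ℕ} (hK : 3 ≤ K) (h : K ≠ 4) (σ : Fin K → Perm (Fin 4)) :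
    (∀ c, (cyclePoly K 4 : ℝ) ≤ cycleCount σ c) ∨
      11 / 10 * (cyclePoly K 4 : ℝ) ^ 4 ≤ ∏ c, (cycleCount σ c : ℝ) := by
  have hP0 : 0 < (cyclePoly K 4 : ℝ) := by exact_mod_cast cyclePoly_pos (by omega) le_rfl
  rcases Nat.even_or_odd K with hev | hodd
  · have h3 : K ≠ 3 := by rintro rfl; exact absurd hev (by decide)
    have h5 : K ≠ 5 := by rintro rfl; exact absurd hev (by decide)
    have hα := walkConst_three_ge_of_odd (odd_pred hev (by omega)) (by omega)
    have hF4 : #(fixedColors σ) ≤ 4 := by simpa using card_le_univ (fixedColors σ)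
    rcases hF4.eq_or_lt with hF | hF
    · left
      intro c
      have hc : c ∈ fixedColors σ := by
        rw [(card_eq_iff_eq_univ (fixedColors σ)).1 (hF.trans (Fintype.card_fin 4).symm)]
        exact mem_univ c
      have := cycleCount_of_mem hev (by omega) σ c hc
      rw [hF] at this
      have : cyclePoly K 4 ≤ cycleCount σ c := by push_cast at this; linarith
      exact_mod_cast this
    · right
      refine le_trans ?_ (prod_cycleCount_ge hev (by omega) le_rfl
        (le_trans (by norm_num) hα) σ)
      rw [mul_comm]
      refine mul_le_mul_of_nonneg_left ?_ (by positivity)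
      have hF' : (#(fixedColors σ) : ℝ) ≤ 3 := by exact_mod_cast (by omega)
      norm_num only [Nat.cast_ofNat]
      set α := walkConst 3 (K - 1) with hαdef
      have hα' : (11 : ℝ) ≤ (α : ℝ) := by exact_mod_cast hα
      have hP : (cyclePoly K 4 : ℝ) = 6 * α := by
        have : cyclePoly K 4 = 6 * α := by rw [cyclePoly, hαdef]; norm_num
        exact_mod_cast this
      have h1 : 1 / (6 * (α : ℝ)) ≤ (4 - #(fixedColors σ) : ℝ) / cyclePoly K 4 := by
        rw [hP]
        gcongr
        linarith
      have h2 : 1 / 10 ≤ 1 / (6 * (α : ℝ)) * (α - 11 / 3) := by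
        rw [one_div_mul_eq_div, div_le_div_iff₀ (by norm_num) (by positivity)]
        linarith
      have h3 := mul_le_mul_of_nonneg_right h1 (show 0 ≤ (α : ℝ) - 11 / 3 by linarith)
      linarith
  · exact Or.inl fun c => cyclePoly_le_cycleCount_of_odd hodd σ c

theorem cyclePoly_four_four : cyclePoly 4 4 = 18 := by norm_num [cyclePoly, walkConst]

/-- With f fixed colors the bounds 14 + f (f times) and 18 + f (4 - f times) always sum to 72; their
product is smallest at f = 2, namely 16² · 20². -/
theorem sum_and_prod_cycleCount_four (σ : Fin 4 → Perm (Fin 4)) :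
    72 ≤ ∑ c, (cycleCount σ c : ℝ) ∧ 102400 ≤ ∏ c, (cycleCount σ c : ℝ) := by
  have hF4 : #(fixedColors σ) ≤ 4 := by simpa using card_le_univ (fixedColors σ)
  have h1 : ∀ c ∈ fixedColors σ, (14 + #(fixedColors σ) : ℝ) ≤ cycleCount σ c := fun c hc => by
    have := cycleCount_of_mem (by decide) (by decide) σ c hc
    norm_num [cyclePoly_four_four] at this
    exact_mod_cast this
  have h2 : ∀ c ∉ fixedColors σ, (18 + #(fixedColors σ) : ℝ) ≤ cycleCount σ c := fun c hc => by
    have := cycleCount_of_notMem (by decide) σ c hc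
    norm_num [cyclePoly_four_four, walkConst] at this
    exact_mod_cast this
  refine ⟨le_trans ?_ (sum_ge_of_bounds _ _ h1 h2),
    le_trans ?_ (prod_ge_of_bounds _ _ (by positivity) (by positivity) h1 h2)⟩ <;>
  · generalize #(fixedColors σ) = f at hF4
    interval_cases f <;> norm_num

theorem mul_prod_le_sum_prod {n m : ℕ} (P : Fin n → ℝ) (hP : ∀ i, 0 < P i)
    (N : Fin n → Fin m → ℝ) (hN : ∀ i c, 0 ≤ N i c) (h : (∏ i, P i) ^ m ≤ ∏ i, ∏ c, N i c) :
    m * ∏ i, P i ≤ ∑ c, ∏ i, N i c := by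
  refine mul_le_sum_of_pow_le_prod _ (fun c => prod_nonneg fun i _ => hN i c)
    (prod_pos fun i _ => hP i) ?_
  rwa [prod_comm]

theorem mul_prod_cyclePoly_le {n m : ℕ} (k : Fin n → ℕ) (hk : ∀ i, 3 ≤ k i) (hm : 4 ≤ m)
    (h : m = 4 → ∀ i j, k i = 4 → k j = 4 → i = j) (σ : ∀ i, Fin (k i) → Perm (Fin m)) :
    (m : ℝ) * ∏ i, (cyclePoly (k i) m : ℝ) ≤ ∑ c, ∏ i, (cycleCount (σ i) c : ℝ) := by
  have hP : ∀ i, 0 < (cyclePoly (k i) m : ℝ) := fun i => by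
    exact_mod_cast cyclePoly_pos (le_trans (by norm_num) (hk i)) hm
  have hN : ∀ i c, 0 ≤ (cycleCount (σ i) c : ℝ) := fun i c => Nat.cast_nonneg _
  by_cases h4 : ∃ i, m = 4 ∧ k i = 4
  · obtain ⟨i₀, rfl, hi₀⟩ := h4
    have hne : ∀ i, i ≠ i₀ → k i ≠ 4 := fun i hi h' => hi (h rfl i i₀ h' hi₀)
    have hsp : 72 ≤ ∑ c, (cycleCount (σ i₀) c : ℝ) ∧
        102400 ≤ ∏ c, (cycleCount (σ i₀) c : ℝ) := by
      generalize σ i₀ = τ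
      revert τ
      rw [hi₀]
      exact sum_and_prod_cycleCount_four
    have hP18 : (cyclePoly (k i₀) 4 : ℝ) = 18 := by rw [hi₀, cyclePoly_four_four]; norm_num
    by_cases hall : ∀ i, i ≠ i₀ → ∀ c, (cyclePoly (k i) 4 : ℝ) ≤ cycleCount (σ i) c
    · simp only [← mul_prod_erase univ _ (mem_univ i₀)]
      calc ((4 : ℕ) : ℝ) * (cyclePoly (k i₀) 4 * ∏ i ∈ univ.erase i₀, (cyclePoly (k i) 4 : ℝ))
          = 72 * ∏ i ∈ univ.erase i₀, (cyclePoly (k i) 4 : ℝ) := by rw [hP18]; push_cast; ring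
        _ ≤ (∑ c, (cycleCount (σ i₀) c : ℝ)) * ∏ i ∈ univ.erase i₀, (cyclePoly (k i) 4 : ℝ) :=
          mul_le_mul_of_nonneg_right hsp.1 (prod_nonneg fun i _ => (hP i).le)
        _ ≤ _ := by
          rw [sum_mul]
          exact sum_le_sum fun c _ => mul_le_mul_of_nonneg_left
            (prod_le_prod (fun i _ => (hP i).le) fun i hi => hall i (ne_of_mem_erase hi) c) (hN _ _)
    · push Not at hall
      obtain ⟨i₁, hi₁, c₁, hc₁⟩ := hall
      have hi₁' := (forall_le_or_prod_ge (hk i₁) (hne i₁ hi₁) (σ i₁)).resolve_left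
        fun h' => absurd (h' c₁) (not_le.2 hc₁)
      refine mul_prod_le_sum_prod _ hP _ hN ?_
      -- The deficit 102400 / 18^4 of the 4-cycle is outweighed by the factor 11/10 from the cycle
      -- `i₁`.
      let d : Fin n → ℝ := fun i => if i = i₀ then 102400 / 104976 else if i = i₁ then 11 / 10 else 1
      have hd0 : ∀ i, 0 ≤ d i := fun i => by simp only [d]; split_ifs <;> norm_num
      have hd : ∏ i, d i = 102400 / 104976 * (11 / 10) := by
        rw [Fintype.prod_eq_mul i₀ i₁ hi₁.symm fun i hi => by simp [d, hi.1, hi.2]]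
        simp [d, hi₁]
      calc (∏ i, (cyclePoly (k i) 4 : ℝ)) ^ 4
          ≤ (∏ i, d i) * (∏ i, (cyclePoly (k i) 4 : ℝ)) ^ 4 := by
            rw [hd]
            exact le_mul_of_one_le_left (pow_nonneg (prod_nonneg fun i _ => (hP i).le) _)
              (by norm_num)
        _ = ∏ i, d i * (cyclePoly (k i) 4 : ℝ) ^ 4 := by rw [prod_mul_distrib, prod_pow]
        _ ≤ _ := prod_le_prod (fun i _ => mul_nonneg (hd0 i) (pow_nonneg (hP i).le _))
            fun i _ => ?_
      by_cases h0 : i = i₀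
      · subst h0
        simp only [d, if_true, hP18]
        exact le_trans (by norm_num) hsp.2
      · by_cases h1 : i = i₁
        · subst h1
          simpa [d, h0] using hi₁'
        · simpa [d, h0, h1] using pow_cyclePoly_le_prod (hk i) hm (Or.inr (hne i h0)) (σ i)
  · push Not at h4
    refine mul_prod_le_sum_prod _ hP _ hN ?_
    rw [← prod_pow]
    refine prod_le_prod (fun i _ => (pow_pos (hP i) _).le) fun i _ =>
      pow_cyclePoly_le_prod (hk i) hm ?_ (σ i)
    by_cases h5 : m = 4
    · exact Or.inr (h4 i h5)
    · exact Or.inl h5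

/-! ### Twists with too few colorings -/

theorem twist_one (K m : ℕ) : twist K (1 : Perm (Fin m)) = fun _ => 1 := by
  funext j
  simp [twist]

/-- The twisted cycle has counts 2, 2, 0, whereas each untwisted one has 2 for every color. -/
theorem sum_prod_twist_three_lt {n : ℕ} (k : Fin n → ℕ) (hk : ∀ i, 3 ≤ k i) (hev : ∀ i, Even (k i))
    (i₀ : Fin n) :
    ∑ c, ∏ i, (cycleCount (twist (k i) (if i = i₀ then swap (0 : Fin 3) 1 else 1)) c : ℤ) <
      3 * ∏ i, cyclePoly (k i) 3 := by
  have hw : ∀ i, walkConst (((3 : ℕ) : ℤ) - 1) (k i - 1) = 1 := fun i =>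
    walkConst_two_of_odd (odd_pred (hev i) (by linarith [hk i]))
  have hP : ∀ i, cyclePoly (k i) 3 = 2 := fun i => by rw [cyclePoly, hw]; norm_num
  have h0 : 0 < k i₀ := by linarith [hk i₀]
  have hother : ∀ c, ∏ i ∈ univ.erase i₀,
      (cycleCount (twist (k i) (if i = i₀ then swap (0 : Fin 3) 1 else 1)) c : ℤ) =
      ∏ i ∈ univ.erase i₀, cyclePoly (k i) 3 := fun c => prod_congr rfl fun i hi => by
    rw [if_neg (ne_of_mem_erase hi), twist_one, cycleCount_one (by linarith [hk i])]
  simp only [← mul_prod_erase univ _ (mem_univ i₀), hother, if_true]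
  have c0 := cycleCount_twist_left (hev i₀) h0 (a := (0 : Fin 3)) (b := 1) (by decide)
  have c1 := cycleCount_twist_left (hev i₀) h0 (a := (1 : Fin 3)) (b := 0) (by decide)
  have c2 := cycleCount_twist_of_ne (hev i₀) h0 (a := (0 : Fin 3)) (b := 1) (c := 2)
    (by decide) (by decide) (by decide)
  rw [swap_comm] at c1
  rw [Fin.sum_univ_three, c0, c1, c2, hw, hP]
  have : 0 < ∏ i ∈ univ.erase i₀, cyclePoly (k i) 3 := prod_pos fun i _ => by rw [hP]; norm_num
  linarith

theorem sum_prod_twist_four_lt {n : ℕ} (k : Fin n → ℕ) (hk : ∀ i, 3 ≤ k i) {i₀ i₁ : Fin n}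
    (hi : i₀ ≠ i₁) (h₀ : k i₀ = 4) (h₁ : k i₁ = 4) :
    ∑ c, ∏ i, (cycleCount (twist (k i)
      (if i = i₀ then swap (0 : Fin 4) 1 else if i = i₁ then swap 2 3 else 1)) c : ℤ) <
      4 * ∏ i, cyclePoly (k i) 4 := by
  have hi' : i₁ ∈ univ.erase i₀ := mem_erase.2 ⟨hi.symm, mem_univ _⟩
  have hother : ∀ c, ∏ i ∈ (univ.erase i₀).erase i₁, (cycleCount (twist (k i)
      (if i = i₀ then swap (0 : Fin 4) 1 else if i = i₁ then swap 2 3 else 1)) c : ℤ) =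
      ∏ i ∈ (univ.erase i₀).erase i₁, cyclePoly (k i) 4 := fun c => prod_congr rfl fun i hi => by
    rw [if_neg (ne_of_mem_erase (mem_of_mem_erase hi)), if_neg (ne_of_mem_erase hi), twist_one,
      cycleCount_one (by linarith [hk i])]
  simp only [← mul_prod_erase univ _ (mem_univ i₀), ← mul_prod_erase _ _ hi', hother, if_true,
    if_neg hi.symm]
  have hl : ∀ a b : Fin 4, a ≠ b → (cycleCount (twist 4 (swap a b)) a : ℤ) = 20 := fun a b h => by
    rw [cycleCount_twist_left (by decide) (by decide) h, cyclePoly_four_four]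
    norm_num [walkConst]
  have hn : ∀ a b c : Fin 4, a ≠ b → a ≠ c → b ≠ c →
      (cycleCount (twist 4 (swap a b)) c : ℤ) = 16 := fun a b c h1 h2 h3 => by
    rw [cycleCount_twist_of_ne (by decide) (by decide) h1 h2 h3, cyclePoly_four_four]
    norm_num
  have hr : ∀ a b : Fin 4, a ≠ b → (cycleCount (twist 4 (swap a b)) b : ℤ) = 20 := fun a b h => by
    rw [swap_comm]
    exact hl b a h.symm
  have hpos : 0 < ∏ i ∈ (univ.erase i₀).erase i₁, cyclePoly (k i) 4 :=
    prod_pos fun i _ => cyclePoly_pos (by linarith [hk i]) le_rfl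
  rw [h₀, h₁, Fin.sum_univ_four, hl 0 1 (by decide), hr 0 1 (by decide), hl 2 3 (by decide),
    hr 2 3 (by decide), hn 0 1 2 (by decide) (by decide) (by decide),
    hn 0 1 3 (by decide) (by decide) (by decide), hn 2 3 0 (by decide) (by decide) (by decide),
    hn 2 3 1 (by decide) (by decide) (by decide), cyclePoly_four_four]
  linarith

/-! ### Covers given by permutations -/

/-- The number of colorings of `G` from the cover with lists `Fin m` and matchings `φ`. -/
noncomputable def permCount {V : Type*} (G : SimpleGraph V) {m : ℕ} (φ : V → V → Perm (Fin m)) :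
    ℕ :=
  Nat.card {f : V → Fin m // ∀ u v, G.Adj u v → φ u v (f u) ≠ f v}

theorem chromaticCount_eq_permCount {V : Type*} (G : SimpleGraph V) (m : ℕ) :
    chromaticCount G m = permCount G (m := m) fun _ _ => 1 :=
  Nat.card_congr
    { toFun := fun C => ⟨C, fun _ _ h => C.valid h⟩
      invFun := fun f => SimpleGraph.Coloring.mk f.1 fun h => f.2 _ _ h
      left_inv := fun _ => rfl
      right_inv := fun _ => rfl }

/-- The cover with lists `Fin m` and matchings `φ`. -/
def permCover {V : Type*} (G : SimpleGraph V) {m : ℕ} (hm : 0 < m) (φ : V → V → Perm (Fin m))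
    (hφ : ∀ u v, G.Adj u v → φ v u = (φ u v)⁻¹) : Cover G (V × Fin m) where
  H :=
    { Adj := fun p q => (p.1 = q.1 ∧ p.2 ≠ q.2) ∨ (G.Adj p.1 q.1 ∧ φ p.1 q.1 p.2 = q.2)
      symm := ⟨by
        rintro p q (⟨h1, h2⟩ | ⟨h1, h2⟩)
        · exact Or.inl ⟨h1.symm, h2.symm⟩
        · refine Or.inr ⟨h1.symm, ?_⟩
          rw [hφ _ _ h1, ← h2, Perm.inv_def, Equiv.symm_apply_apply]⟩
      loopless := ⟨by
        rintro p (⟨-, h⟩ | ⟨h, -⟩)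
        · exact h rfl
        · exact G.loopless.irrefl _ h⟩ }
  L u := {p | p.1 = u}
  nonempty u := ⟨(u, ⟨0, hm⟩), rfl⟩
  partition p := ⟨p.1, rfl, fun _ h => h.symm⟩
  isClique u p hp q hq hpq :=
    Or.inl ⟨hp.trans hq.symm, fun h => hpq (Prod.ext (hp.trans hq.symm) h)⟩
  eq_or_adj := by
    rintro u v p q rfl rfl (⟨h, -⟩ | ⟨h, -⟩)
    · exact Or.inl h
    · exact Or.inr h
  matching := by
    rintro u v huv p rfl q rfl z hz (⟨h, -⟩ | ⟨-, h⟩) (⟨h', -⟩ | ⟨-, h'⟩)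
    · exact absurd h huv.ne
    · exact absurd h huv.ne
    · exact absurd (h'.trans hz) huv.ne
    · refine Prod.ext (Eq.symm hz) ?_
      rw [← h, ← h', show z.1 = q.1 from hz]

theorem encard_range_of_injective {α β : Type*} {f : α → β} (hf : f.Injective) :
    (Set.range f).encard = ENat.card α := by
  rw [← Set.image_univ, hf.encard_image, Set.encard_univ]

theorem permCover_isFold {V : Type*} {G : SimpleGraph V} {m : ℕ} (hm : 0 < m)
    (φ : V → V → Perm (Fin m)) (hφ : ∀ u v, G.Adj u v → φ v u = (φ u v)⁻¹) :
    (permCover G hm φ hφ).IsFold m := fun u => by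
  have : (permCover G hm φ hφ).L u = Set.range (Prod.mk u : Fin m → V × Fin m) := by
    ext ⟨v, a⟩
    simp [permCover, eq_comm]
  rw [this, encard_range_of_injective (Prod.mk_right_injective u)]
  simp

/-- An independent set meets each clique `L u` at most once; having |V| elements, it meets each
exactly once and is the graph of a function. -/
theorem ncard_colorings_permCover {V : Type*} [Finite V] {G : SimpleGraph V} {m : ℕ} (hm : 0 < m)
    (φ : V → V → Perm (Fin m)) (hφ : ∀ u v, G.Adj u v → φ v u = (φ u v)⁻¹) :
    (permCover G hm φ hφ).colorings.ncard = permCount G φ := by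
  symm
  have hinj : ∀ f : V → Fin m, Function.Injective fun v => (v, f v) := fun f u v h =>
    congrArg Prod.fst h
  refine Nat.card_eq_of_bijective
    (fun f => (⟨Set.range fun v => (v, f.1 v), ?_, encard_range_of_injective (hinj _)⟩ :
      (permCover G hm φ hφ).colorings)) ⟨fun f g hfg => ?_, ?_⟩
  · rintro _ ⟨u, rfl⟩ _ ⟨v, rfl⟩ - (⟨h1, h2⟩ | ⟨h1, h2⟩)
    · exact h2 (congrArg f.1 h1)
    · exact f.2 u v h1 h2
  · refine Subtype.ext (funext fun v => ?_)
    have h : Set.range (fun v => (v, f.1 v)) = Set.range fun v => (v, g.1 v) :=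
      congrArg Subtype.val hfg
    obtain ⟨w, hw⟩ : (v, f.1 v) ∈ Set.range fun v => (v, g.1 v) := h ▸ ⟨v, rfl⟩
    obtain ⟨rfl, h2⟩ := Prod.ext_iff.1 hw
    exact h2.symm
  · rintro ⟨I, hI, hcard⟩
    have hIinj : Set.InjOn Prod.fst I := fun p hp q hq hpq => by
      by_contra hne
      exact hI hp hq hne (Or.inl ⟨hpq, fun h => hne (Prod.ext hpq h)⟩)
    have huniv : Prod.fst '' I = Set.univ :=
      (Set.toFinite _).eq_of_subset_of_encard_le (Set.subset_univ _)
        (by rw [hIinj.encard_image, hcard, Set.encard_univ])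
    have hex : ∀ v, ∃ a, (v, a) ∈ I := fun v => by
      obtain ⟨p, hp, rfl⟩ : v ∈ Prod.fst '' I := huniv ▸ Set.mem_univ v
      exact ⟨p.2, hp⟩
    choose f hf using hex
    refine ⟨⟨f, fun u v huv h => hI (hf u) (hf v) ?_ (Or.inr ⟨huv, h⟩)⟩, Subtype.ext ?_⟩
    · exact fun h => huv.ne (congrArg Prod.fst h)
    · refine Set.Subset.antisymm (Set.range_subset_iff.2 hf) fun p hp => ⟨p.1, ?_⟩
      exact hIinj (hf p.1) hp rfl

theorem exists_equiv_of_partial {A B : Type*} [Finite A] [Finite B] (hAB : Nat.card A = Nat.card B)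
    (R : A → B → Prop) (hR : ∀ a b b', R a b → R a b' → b = b')
    (hR' : ∀ a a' b, R a b → R a' b → a = a') : ∃ e : A ≃ B, ∀ a b, R a b → e a = b := by
  classical
  have := Fintype.ofFinite A
  have := Fintype.ofFinite B
  rcases isEmpty_or_nonempty A with hA | ⟨⟨a₀⟩⟩
  · exact ⟨(Finite.card_eq.1 hAB).some, fun a => hA.elim a⟩
  have : Nonempty B := (Finite.card_eq.1 hAB).some.nonempty_congr.1 ⟨a₀⟩
  have hex : ∀ a, ∃ b, (∃ b', R a b') → R a b := fun a => by
    -- Off the domain of `R` the value is arbitrary, as only the restriction to the domain is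
    -- extended.
    by_cases h : ∃ b', R a b'
    · exact h.imp fun b hb _ => hb
    · exact ⟨Classical.arbitrary B, fun h' => absurd h' h⟩
  choose f hf using hex
  have hfs : Set.InjOn f {a | ∃ b, R a b} := fun a ha a' ha' h =>
    hR' a a' (f a) (hf a ha) (h ▸ hf a' ha')
  obtain ⟨g, hg⟩ := Set.MapsTo.exists_equiv_extend_of_card_eq (t := (Finset.univ : Finset B))
    (by rw [card_univ, ← Nat.card_eq_fintype_card, hAB, Nat.card_eq_fintype_card])
    (fun a _ => by simp) hfs
  refine ⟨g.trans (Equiv.subtypeUnivEquiv fun b => mem_univ b), fun a b hab => ?_⟩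
  have := hg a ⟨b, hab⟩
  simpa [this] using hR a _ _ (hf a ⟨b, hab⟩) hab

/-- A cover can be trivialised along the edges at a vertex `w`. -/
theorem exists_permCount_le {V : Type*} [Finite V] {G : SimpleGraph V} {W : Type*} [Finite W]
    (C : Cover G W) {m : ℕ} (hC : C.IsFold m) (w : V) :
    ∃ φ : V → V → Perm (Fin m), (∀ u v, G.Adj u v → φ v u = (φ u v)⁻¹) ∧
      (∀ v, G.Adj w v → φ w v = 1) ∧ permCount G φ ≤ C.colorings.ncard := by
  classical
  have hcard : ∀ v, Nat.card (Fin m) = Nat.card (C.L v) := fun v => by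
    change _ = (C.L v).ncard
    rw [Set.ncard, hC v]
    simp
  have hm' : ∀ u v, G.Adj u v → ∀ x ∈ C.L u, ∀ x' ∈ C.L u, ∀ y ∈ C.L v,
      C.H.Adj x y → C.H.Adj x' y → x = x' := fun u v huv x hx x' hx' y hy h h' =>
    C.matching v u huv.symm y hy x hx x' hx' h.symm h'.symm
  obtain ⟨e₀⟩ := Finite.card_eq.1 (hcard w)
  -- The colors at a neighbor of `w` are named after their partners in `L w`.
  have he : ∀ v, ∃ e : Fin m ≃ C.L v, (v = w → ∀ a, (e a : W) = e₀ a) ∧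
      (G.Adj w v → ∀ a b, C.H.Adj (e₀ a) (e b) → a = b) := fun v => by
    by_cases hv : v = w
    · subst hv
      exact ⟨e₀, fun _ _ => rfl, fun h => absurd h (G.loopless.irrefl _)⟩
    by_cases hwv : G.Adj w v
    · obtain ⟨e, he⟩ := exists_equiv_of_partial (hcard v) (fun a y => C.H.Adj (e₀ a) (y : W))
        (fun a y y' h h' => Subtype.ext (C.matching w v hwv _ (e₀ a).2 _ y.2 _ y'.2 h h'))
        (fun a a' y h h' => e₀.injective (Subtype.ext
          (hm' w v hwv _ (e₀ a).2 _ (e₀ a').2 _ y.2 h h')))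
      exact ⟨e, fun h => absurd h hv, fun _ a b h => e.injective (he a _ h)⟩
    · obtain ⟨e⟩ := Finite.card_eq.1 (hcard v)
      exact ⟨e, fun h => absurd h hv, fun h => absurd h hwv⟩
  choose e hew hewv using he
  have hψ : ∀ u v, ∃ ψ : Perm (Fin m), (u = w ∨ v = w → ψ = 1) ∧
      (G.Adj u v → ∀ a b, C.H.Adj (e u a) (e v b) → ψ a = b) := fun u v => by
    by_cases huv : G.Adj u v
    · by_cases hu : u = w
      · subst hu
        exact ⟨1, fun _ => rfl, fun _ a b h => hewv v huv a b (by rwa [hew u rfl] at h)⟩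
      by_cases hv : v = w
      · subst hv
        refine ⟨1, fun _ => rfl, fun _ a b h => (hewv u huv.symm b a ?_).symm⟩
        rw [hew v rfl] at h
        exact h.symm
      obtain ⟨ψ, hψ⟩ := exists_equiv_of_partial rfl (fun a b => C.H.Adj (e u a) (e v b))
        (fun a b b' h h' => (e v).injective (Subtype.ext
          (C.matching u v huv _ (e u a).2 _ (e v b).2 _ (e v b').2 h h')))
        (fun a a' b h h' => (e u).injective (Subtype.ext
          (hm' u v huv _ (e u a).2 _ (e u a').2 _ (e v b).2 h h')))
      exact ⟨ψ, fun h => absurd h (not_or.2 ⟨hu, hv⟩), fun _ => hψ⟩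
    · exact ⟨1, fun _ => rfl, fun h => absurd h huv⟩
  choose ψ hψw hψ using hψ
  -- The completions `ψ u v` and `ψ v u` were chosen independently; an arbitrary order selects one
  -- per edge and makes `φ v u` the inverse of `φ u v`.
  let _ : LinearOrder V := linearOrderOfSTO WellOrderingRel
  let φ : V → V → Perm (Fin m) := fun u v => if u < v then ψ u v else (ψ v u)⁻¹
  have hφ : ∀ u v, G.Adj u v → ∀ a b, C.H.Adj (e u a) (e v b) → φ u v a = b := by
    intro u v huv a b h
    by_cases hlt : u < v
    · simp only [φ, if_pos hlt]
      exact hψ u v huv a b h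
    · simp only [φ, if_neg hlt]
      rw [Perm.inv_eq_iff_eq]
      exact (hψ v u huv.symm b a h.symm).symm
  refine ⟨φ, fun u v huv => ?_, fun v hv => ?_, ?_⟩
  · rcases lt_or_gt_of_ne huv.ne with h | h
    · simp [φ, h, h.not_gt]
    · simp [φ, h, h.not_gt]
  · simp only [φ, hψw w v (Or.inl rfl), hψw v w (Or.inr rfl), inv_one, ite_self]
  have hdisj : ∀ u v a b, (e u a : W) = e v b → u = v := fun u v a b h =>
    (C.partition (e u a)).unique (e u a).2 (h ▸ (e v b).2)
  refine Nat.card_le_card_of_injective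
    (fun f => (⟨Set.range fun v => (e v (f.1 v) : W), ?_, ?_⟩ : C.colorings)) fun f g hfg => ?_
  · rintro _ ⟨u, rfl⟩ _ ⟨v, rfl⟩ hne h
    rcases C.eq_or_adj u v _ _ (e u _).2 (e v _).2 h with rfl | huv
    · exact hne rfl
    · exact f.2 u v huv (hφ u v huv _ _ h)
  · exact encard_range_of_injective fun u v h => hdisj u v _ _ h
  · refine Subtype.ext (funext fun v => ?_)
    have h : Set.range (fun v => (e v (f.1 v) : W)) = Set.range fun v => (e v (g.1 v) : W) :=
      congrArg Subtype.val hfg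
    obtain ⟨u, hu⟩ : (e v (f.1 v) : W) ∈ Set.range fun v => (e v (g.1 v) : W) := h ▸ ⟨v, rfl⟩
    obtain rfl := hdisj _ _ _ _ hu
    exact ((e u).injective (Subtype.ext hu)).symm

theorem dpColorFunction_le_permCount {V : Type} [Finite V] (G : SimpleGraph V) {m : ℕ} (hm : 0 < m)
    (φ : V → V → Perm (Fin m)) (hφ : ∀ u v, G.Adj u v → φ v u = (φ u v)⁻¹) :
    dpColorFunction G m ≤ permCount G φ :=
  Nat.sInf_le ⟨V × Fin m, inferInstance, permCover G hm φ hφ, permCover_isFold hm φ hφ,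
    (ncard_colorings_permCover hm φ hφ).symm⟩

theorem dpColorFunction_eq_chromaticCount {V : Type} [Finite V] (G : SimpleGraph V) {m : ℕ}
    (hm : 0 < m) (w : V) (h : ∀ φ : V → V → Perm (Fin m),
      (∀ u v, G.Adj u v → φ v u = (φ u v)⁻¹) → (∀ v, G.Adj w v → φ w v = 1) →
      chromaticCount G m ≤ permCount G φ) :
    dpColorFunction G m = chromaticCount G m := by
  refine le_antisymm ?_ (le_csInf ?_ ?_)
  · rw [chromaticCount_eq_permCount]
    exact dpColorFunction_le_permCount G hm _ fun _ _ _ => inv_one.symm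
  -- The set of counts must be nonempty, since the infimum of the empty set in `ℕ` is 0.
  · exact ⟨_, V × Fin m, inferInstance, permCover G hm (fun _ _ => 1) fun _ _ _ => inv_one.symm,
      permCover_isFold hm _ _, rfl⟩
  · rintro N ⟨W, _, C, hC, rfl⟩
    obtain ⟨φ, h1, h2, h3⟩ := exists_permCount_le C hC w
    exact (h φ h1 h2).trans h3

/-! ### The cone over disjoint cycles -/

theorem cycleGraph_adj_iff {K : ℕ} (hK : 2 ≤ K) (a b : Fin K) :
    (SimpleGraph.cycleGraph K).Adj a b ↔ finRotate K a = b ∨ finRotate K b = a := by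
  obtain ⟨k, rfl⟩ := Nat.exists_eq_add_of_le' hK
  rw [SimpleGraph.cycleGraph_adj, finRotate_apply, finRotate_apply, sub_eq_iff_eq_add',
    sub_eq_iff_eq_add', or_comm, @eq_comm _ b, @eq_comm _ a]

theorem forall_disjointCycles_adj {n : ℕ} (k : Fin n → ℕ) (hk : ∀ i, 3 ≤ k i)
    (p : (Σ i, Fin (k i)) → (Σ i, Fin (k i)) → Prop)
    (hp : ∀ u v, (disjointCycles k).Adj u v → p u v → p v u) :
    (∀ u v, (disjointCycles k).Adj u v → p u v) ↔
      ∀ i (j : Fin (k i)), p ⟨i, j⟩ ⟨i, finRotate (k i) j⟩ := by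
  have hadj : ∀ i (j : Fin (k i)), (disjointCycles k).Adj ⟨i, j⟩ ⟨i, finRotate (k i) j⟩ :=
    fun i j => SimpleGraph.iSup_adj.2 ⟨i, (SimpleGraph.map_adj _ _ _ _).2
      ⟨j, finRotate (k i) j, (cycleGraph_adj_iff (by linarith [hk i]) _ _).2 (Or.inl rfl),
        rfl, rfl⟩⟩
  refine ⟨fun h i j => h _ _ (hadj i j), fun h u v huv => ?_⟩
  obtain ⟨i, hi⟩ := SimpleGraph.iSup_adj.1 huv
  obtain ⟨a, b, hab, rfl, rfl⟩ := (SimpleGraph.map_adj _ _ _ _).1 hi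
  rcases (cycleGraph_adj_iff (by linarith [hk i]) _ _).1 hab with rfl | rfl
  · exact h i a
  · exact hp _ _ (hadj i b) (h i b)

theorem cone_adj_inl_inr {V : Type*} (G : SimpleGraph V) (a : Fin 1) (v : V) :
    (cone G).Adj (Sum.inl a) (Sum.inr v) := by
  simp [cone, join]

theorem cone_adj_inr_inl {V : Type*} (G : SimpleGraph V) (a : Fin 1) (v : V) :
    (cone G).Adj (Sum.inr v) (Sum.inl a) := by
  simp [cone, join]

theorem cone_adj_inr_inr {V : Type*} (G : SimpleGraph V) (u v : V) :
    (cone G).Adj (Sum.inr u) (Sum.inr v) ↔ G.Adj u v := by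
  simp [cone, join]

theorem cone_adj_inl_inl {V : Type*} (G : SimpleGraph V) (a b : Fin 1) :
    ¬ (cone G).Adj (Sum.inl a) (Sum.inl b) := by
  simp [cone, join, Subsingleton.elim a b]

/-- Once the color `c` of the apex is chosen, the identity matchings at the apex merely erase `c`
from every list, and the cycles become independent. -/
theorem permCount_cone_disjointCycles {n m : ℕ} (k : Fin n → ℕ) (hk : ∀ i, 3 ≤ k i)
    (φ : (Fin 1 ⊕ Σ i, Fin (k i)) → (Fin 1 ⊕ Σ i, Fin (k i)) → Perm (Fin m))
    (hφ : ∀ u v, (cone (disjointCycles k)).Adj u v → φ v u = (φ u v)⁻¹)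
    (hφ1 : ∀ v, φ (Sum.inl 0) (Sum.inr v) = 1) :
    permCount (cone (disjointCycles k)) φ = ∑ c, ∏ i, cycleCount
      (fun j => φ (Sum.inr ⟨i, j⟩) (Sum.inr ⟨i, finRotate (k i) j⟩)) c := by
  have hφ2 : ∀ v, φ (Sum.inr v) (Sum.inl 0) = 1 := fun v => by
    rw [hφ _ _ (cone_adj_inl_inr _ 0 v), hφ1, inv_one]
  have key : ∀ f : (Fin 1 ⊕ Σ i, Fin (k i)) → Fin m,
      (∀ u v, (cone (disjointCycles k)).Adj u v → φ u v (f u) ≠ f v) ↔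
      (∀ v, f (Sum.inr v) ≠ f (Sum.inl 0)) ∧
        ∀ i (j : Fin (k i)), ¬ φ (Sum.inr ⟨i, j⟩) (Sum.inr ⟨i, finRotate (k i) j⟩)
          (f (Sum.inr ⟨i, j⟩)) = f (Sum.inr ⟨i, finRotate (k i) j⟩) := fun f => by
    have := forall_disjointCycles_adj k hk
      (fun u v => ¬ φ (Sum.inr u) (Sum.inr v) (f (Sum.inr u)) = f (Sum.inr v))
      fun u v huv h h' => by
        rw [hφ _ _ ((cone_adj_inr_inr _ _ _).2 huv), Perm.inv_eq_iff_eq] at h'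
        exact h h'.symm
    rw [← this]
    constructor
    · intro h
      refine ⟨fun v => ?_, fun u v huv => h _ _ ((cone_adj_inr_inr _ _ _).2 huv)⟩
      simpa [hφ2] using h _ _ (cone_adj_inr_inl _ 0 v)
    · rintro ⟨h1, h2⟩ (u | u) (v | v) huv
      · exact absurd huv (cone_adj_inl_inl _ _ _)
      · rw [Subsingleton.elim u 0, hφ1]
        exact (h1 v).symm
      · rw [Subsingleton.elim v 0, hφ2]
        exact h1 u
      · exact h2 u v ((cone_adj_inr_inr _ _ _).1 huv)
  have e : {f : (Fin 1 ⊕ Σ i, Fin (k i)) → Fin m //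
      ∀ u v, (cone (disjointCycles k)).Adj u v → φ u v (f u) ≠ f v} ≃
      Σ c : Fin m, ∀ i, {g : Fin (k i) → {x // x ≠ c} //
        ∀ j, ¬ φ (Sum.inr ⟨i, j⟩) (Sum.inr ⟨i, finRotate (k i) j⟩) (g j) =
          (g (finRotate (k i) j) : Fin m)} :=
    { toFun := fun f => ⟨f.1 (Sum.inl 0), fun i => ⟨fun j => ⟨f.1 (Sum.inr ⟨i, j⟩),
        ((key f.1).1 f.2).1 _⟩, ((key f.1).1 f.2).2 i⟩⟩
      invFun := fun p => ⟨Sum.elim (fun _ => p.1) fun v => (p.2 v.1).1 v.2,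
        (key _).2 ⟨fun v => ((p.2 v.1).1 v.2).2, fun i => (p.2 i).2⟩⟩
      left_inv := fun f => Subtype.ext <| funext fun u => by
        rcases u with u | u
        · rw [Subsingleton.elim u 0]; rfl
        · rfl
      right_inv := fun _ => rfl }
  rw [permCount, Nat.card_congr e, Nat.card_sigma]
  exact sum_congr rfl fun c _ => Nat.card_pi

theorem chromaticCount_cone_disjointCycles {n m : ℕ} (k : Fin n → ℕ) (hk : ∀ i, 3 ≤ k i) :
    (chromaticCount (cone (disjointCycles k)) m : ℤ) = m * ∏ i, cyclePoly (k i) m := by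
  rw [chromaticCount_eq_permCount, permCount_cone_disjointCycles k hk _
    (fun _ _ _ => inv_one.symm) fun _ => rfl]
  push_cast
  rw [sum_congr rfl fun c _ => prod_congr rfl fun i _ => cycleCount_one (by linarith [hk i]) c]
  simp

theorem dpColorFunction_cone_eq {n m : ℕ} (k : Fin n → ℕ) (hk : ∀ i, 3 ≤ k i) (hm : 4 ≤ m)
    (h : m = 4 → ∀ i j, k i = 4 → k j = 4 → i = j) :
    dpColorFunction (cone (disjointCycles k)) m = chromaticCount (cone (disjointCycles k)) m := by
  refine dpColorFunction_eq_chromaticCount _ (by omega) (Sum.inl 0) fun φ hφ hφ1 => ?_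
  rw [permCount_cone_disjointCycles k hk φ hφ fun v => hφ1 _ (cone_adj_inl_inr _ _ _)]
  have h1 := mul_prod_cyclePoly_le k hk hm h
    fun i j => φ (Sum.inr ⟨i, j⟩) (Sum.inr ⟨i, finRotate (k i) j⟩)
  have h2 : (chromaticCount (cone (disjointCycles k)) m : ℝ) =
      m * ∏ i, (cyclePoly (k i) m : ℝ) := by
    exact_mod_cast chromaticCount_cone_disjointCycles (m := m) k hk
  rw [← h2] at h1
  exact_mod_cast h1

/-! ### Twisted covers of the cone and the threshold -/

/-- Matchings for the cone over disjoint cycles: on the edge closing up the `i`-th cycle the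
matching is `π i`, all other matchings are trivial. -/
def twistMatching {n m : ℕ} (k : Fin n → ℕ) (π : Fin n → Perm (Fin m)) :
    (Fin 1 ⊕ Σ i, Fin (k i)) → (Fin 1 ⊕ Σ i, Fin (k i)) → Perm (Fin m)
  | Sum.inr u, Sum.inr v =>
    if u.1 = v.1 ∧ (((u.2 : ℕ) = 0 ∧ (v.2 : ℕ) + 1 = k v.1) ∨
      ((v.2 : ℕ) = 0 ∧ (u.2 : ℕ) + 1 = k u.1)) then π u.1 else 1
  | _, _ => 1

theorem twistMatching_symm {n m : ℕ} (k : Fin n → ℕ) {π : Fin n → Perm (Fin m)}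
    (hπ : ∀ i, (π i)⁻¹ = π i) (u v : Fin 1 ⊕ Σ i, Fin (k i)) :
    twistMatching k π v u = (twistMatching k π u v)⁻¹ := by
  rcases u with u | u <;> rcases v with v | v
  · exact inv_one.symm
  · exact inv_one.symm
  · exact inv_one.symm
  · by_cases h : u.1 = v.1
    · simp only [twistMatching, h, true_and]
      rw [if_congr or_comm rfl rfl]
      split_ifs
      · exact (hπ _).symm
      · exact inv_one.symm
    · simp only [twistMatching, h, Ne.symm h, false_and, if_false, inv_one]

theorem twistMatching_finRotate {n m : ℕ} (k : Fin n → ℕ) (π : Fin n → Perm (Fin m)) {i : Fin n}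
    (hi : 3 ≤ k i) (j : Fin (k i)) :
    twistMatching k π (Sum.inr ⟨i, j⟩) (Sum.inr ⟨i, finRotate (k i) j⟩) = twist (k i) (π i) j := by
  simp only [twistMatching, twist, true_and]
  generalize k i = K at hi j
  -- Length at least 3 rules out that the edge from 0 to 1 is also the closing edge.
  obtain ⟨K, rfl⟩ := Nat.exists_eq_add_of_le' hi
  refine if_congr ?_ rfl rfl
  rcases (Fin.le_last j).eq_or_lt with rfl | hj
  · simp
  · have : (finRotate (K + 3) j : ℕ) = j + 1 := coe_finRotate_of_ne_last hj.ne
    have hj' : (j : ℕ) < K + 2 := hj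
    omega

theorem dpColorFunction_le_sum_prod_twist {n m : ℕ} (k : Fin n → ℕ) (hk : ∀ i, 3 ≤ k i)
    (hm : 0 < m) {π : Fin n → Perm (Fin m)} (hπ : ∀ i, (π i)⁻¹ = π i) :
    dpColorFunction (cone (disjointCycles k)) m ≤
      ∑ c, ∏ i, cycleCount (twist (k i) (π i)) c := by
  refine (dpColorFunction_le_permCount _ hm (twistMatching k π)
    fun u v _ => twistMatching_symm k hπ u v).trans_eq ?_
  rw [permCount_cone_disjointCycles k hk _ (fun u v _ => twistMatching_symm k hπ u v)
    fun _ => rfl]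
  simp only [twistMatching_finRotate k π (hk _)]

theorem chromaticCount_pos_iff {V : Type*} [Finite V] (G : SimpleGraph V) (m : ℕ) :
    0 < chromaticCount G m ↔ G.Colorable m := by
  have : Finite (G.Coloring (Fin m)) := DFunLike.finite _
  rw [chromaticCount, Nat.card_pos_iff, and_iff_left this]
  rfl

theorem dpColorFunction_ne_of_colorable_three {n : ℕ} (hn : 1 ≤ n) (k : Fin n → ℕ)
    (hk : ∀ i, 3 ≤ k i) (h : (cone (disjointCycles k)).Colorable 3) :
    dpColorFunction (cone (disjointCycles k)) 3 ≠ chromaticCount (cone (disjointCycles k)) 3 := by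
  have hP := chromaticCount_cone_disjointCycles (m := 3) k hk
  -- An odd cycle has no proper 2-coloring, so its factor would make the chromatic count 0.
  have hev : ∀ i, Even (k i) := fun i => by
    by_contra hodd
    have hw : walkConst 2 (k i - 1) = 0 :=
      walkConst_two_of_even (Nat.Odd.sub_odd (Nat.not_even_iff_odd.1 hodd) odd_one)
    have h0 : cyclePoly (k i) 3 = 0 := by norm_num [cyclePoly, hw]
    rw [prod_eq_zero (mem_univ i) h0, mul_zero, Nat.cast_eq_zero] at hP
    exact ((chromaticCount_pos_iff _ 3).2 h).ne' hP
  have hlt := sum_prod_twist_three_lt k hk hev ⟨0, hn⟩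
  have hle := dpColorFunction_le_sum_prod_twist k hk (m := 3) (by norm_num)
    (π := fun i => if i = ⟨0, hn⟩ then swap 0 1 else 1) fun i => by
      split_ifs
      · exact swap_inv _ _
      · exact inv_one
  zify at hle
  intro heq
  rw [heq, hP] at hle
  exact absurd hlt (not_lt.2 hle)

theorem dpColorFunction_four_ne {n : ℕ} (k : Fin n → ℕ) (hk : ∀ i, 3 ≤ k i) {i j : Fin n}
    (hij : i ≠ j) (hi : k i = 4) (hj : k j = 4) :
    dpColorFunction (cone (disjointCycles k)) 4 ≠ chromaticCount (cone (disjointCycles k)) 4 := by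
  have hP := chromaticCount_cone_disjointCycles (m := 4) k hk
  have hlt := sum_prod_twist_four_lt k hk hij hi hj
  have hle := dpColorFunction_le_sum_prod_twist k hk (m := 4) (by norm_num)
    (π := fun l => if l = i then swap 0 1 else if l = j then swap 2 3 else 1) fun l => by
      split_ifs
      · exact swap_inv _ _
      · exact swap_inv _ _
      · exact inv_one
  zify at hle
  intro heq
  rw [heq, hP] at hle
  exact absurd hlt (not_lt.2 hle)

theorem colorable_four_cone {n : ℕ} (k : Fin n → ℕ) (hk : ∀ i, 3 ≤ k i) :
    (cone (disjointCycles k)).Colorable 4 := by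
  rw [← chromaticCount_pos_iff]
  have h : (0 : ℤ) < chromaticCount (cone (disjointCycles k)) 4 := by
    rw [chromaticCount_cone_disjointCycles k hk]
    exact mul_pos (by norm_num) (prod_pos fun i _ => cyclePoly_pos (by linarith [hk i]) le_rfl)
  exact_mod_cast h

theorem dpThreshold_eq {V : Type*} {G : SimpleGraph V} {t : ℕ} (hχ : G.Colorable t)
    (heq : ∀ m, t ≤ m → dpColorFunction G m = chromaticCount G m)
    (hne : ∀ N < t, G.Colorable N → ∃ m ≥ N, dpColorFunction G m ≠ chromaticCount G m) :
    dpThreshold G = t := by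
  refine le_antisymm (sInf_le ⟨t, rfl, hχ.chromaticNumber_le, heq⟩) (le_sInf ?_)
  rintro _ ⟨N, rfl, hN, h⟩
  by_contra hlt
  obtain ⟨m, hm, hm'⟩ := hne N (by exact_mod_cast not_le.1 hlt)
    (SimpleGraph.chromaticNumber_le_iff_colorable.1 hN)
  exact hm' (h m hm)

end DPColoring

theorem mainTheorem1 (n : ℕ) (hn : 1 ≤ n) (k : Fin n → ℕ) (hk : ∀ i, 3 ≤ k i) :
    ((∃ i j, i ≠ j ∧ k i = 4 ∧ k j = 4) →
      DPColoring.dpThreshold (DPColoring.cone (DPColoring.disjointCycles k)) = 5) ∧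
    ((¬ ∃ i j, i ≠ j ∧ k i = 4 ∧ k j = 4) →
      DPColoring.dpThreshold (DPColoring.cone (DPColoring.disjointCycles k)) = 4) := by
  have h4 := DPColoring.colorable_four_cone k hk
  constructor
  · rintro ⟨i, j, hij, hi, hj⟩
    refine DPColoring.dpThreshold_eq (t := 5) (h4.mono (by norm_num))
      (fun m hm => DPColoring.dpColorFunction_cone_eq k hk (by omega) fun h => by omega)
      fun N hN _ => ⟨4, by omega, DPColoring.dpColorFunction_four_ne k hk hij hi hj⟩
  · intro h
    refine DPColoring.dpThreshold_eq (t := 4) h4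
      (fun m hm => DPColoring.dpColorFunction_cone_eq k hk hm fun _ i j hi hj => ?_)
      -- Any admissible N below 4 would include m = 3, where colorability is inherited from N.
      fun N hN hc => ⟨3, by omega, DPColoring.dpColorFunction_ne_of_colorable_three hn k hk
        (hc.mono (by omega))⟩
    by_contra hij
    exact h ⟨i, j, hij, hi, hj⟩
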